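/- Let $d\in\mathbb N$ and $s\ge \tfrac12$. For $\alpha\in\mathbb N^d$ and $z\in\mathbb C^d$ put $e_\alpha(z)=z^\alpha/\sqrt{\alpha!}$. Let $\mathcal A_s(\mathbb C^d)$ be the space of all functions $F=\sum_{\alpha\in\mathbb N^d} c(F,\alpha)\,e_\alpha$ on $\mathbb C^d$ such that for some $r>0$ and some $M\ge 0$, $|c(F,\alpha)|\le M e^{-r|\alpha|^{1/(2s)}}$ for all $\alpha$. It carries the locally convex inductive limit topology of the Banach spaces $\{F:\ \sup_\alpha |c(F,\alpha)|e^{r|\alpha|^{1/(2s)}}<\infty\}$, $r>0$. Let $\mathcal A_s'(\mathbb C^d)$ be its strong dual; a functional $u\in\mathcal A_s'(\mathbb C^d)$ is identified with the entire function $\sum_\alpha u(e_\alpha)e_\alpha$ (the identification given by the $A^2$-pairing, for which the $e_\alpha$ are orthonormal). Let $\wideparen A(\mathbb C^d\times\mathbb C^d)$ be the set of all functions $a$ on $\mathbb C^d\times\mathbb C^d$ of the form $a(z,w)=K(z,\overline w)$ with $K$ analytic on $\mathbb C^{2d}$. For such $a$ let $$\operatorname{Op}_{\mathfrak V}(a)F(z)=\pi^{-d}\int_{\mathbb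 C^d}a(z,w)F(w)e^{(z-w,w)}\,d\lambda(w),\qquad z\in\mathbb C^d,$$ where $(x,y)=\sum_j x_j\overline{y_j}$ and $\lambda$ is Lebesgue measure. Below, $T=\operatorname{Op}_{\mathfrak V}(a)$ means that for every $F$ in the domain of $T$ and every $z\in\mathbb C^d$ this integral converges absolutely and equals $(TF)(z)$. Then the following holds. (1) If $T:\mathcal A_s'(\mathbb C^d)\to\mathcal A_s(\mathbb C^d)$ is linear and continuous, then there is a unique $a\in\wideparen A(\mathbb C^d\times\mathbb C^d)$ such that $T=\operatorname{Op}_{\mathfrak V}(a)$ and, for some $r>0$ and some constant $C$, $$|a(z,w)|\le C e^{\frac12|z-w|^2-r(|z|^{1/s}+|w|^{1/s})},\qquad z,w\in\mathbb C^d.$$ (2) If $T:\mathcal A_s(\mathbb C^d)\to\mathcal A_s'(\mathbb C^d)$ is linear and continuous, then there is a unique $a\in\wideparen A(\mathbb C^d\times\mathbb C^d)$ such that $T=\operatorname{Op}_{\mathfrak V}(a)$ and, for every $r>0$, there is a constant $C=C_r$ with $$|a(z,w)|\le C e^{\frac12|z-w|^2+r(|z|^{1/s}+|w|^{1/s})},\qquad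 z,w\in\mathbb C^d.$$ -/

import Mathlib

open MeasureTheory

noncomputable section

namespace Bargmann

/-- The space `ℂᵈ` with its Euclidean norm, scalar product and Lebesgue measure. -/
abbrev Cd (d : ℕ) : Type := EuclideanSpace ℂ (Fin d)

/-- Coordinatewise complex conjugation on `ℂᵈ`. -/
def conj {d : ℕ} (w : Cd d) : Cd d := WithLp.toLp 2 fun i => star (w i)

/-- The length `|α| = α₁ + ⋯ + α_d` of a multi-index. -/
def len {d : ℕ} (α : Fin d → ℕ) : ℕ := ∑ i, α i

/-- The normalized monomial `e_α(z) = z^α / √(α!)`. -/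
def e {d : ℕ} (α : Fin d → ℕ) (z : Cd d) : ℂ :=
  (∏ i, z i ^ α i) / (Real.sqrt (∏ i, ((α i).factorial : ℝ)) : ℂ)

/-- `F(z) = ∑_α c(F,α) e_α(z)` on all of `ℂᵈ`, with `|c(F,α)| ≤ M e^{-r |α|^{1/(2s)}}` for all `α`.
For fixed `r` this says that the norm `sup_α |c(F,α)| e^{r |α|^{1/(2s)}}` of `F` is at most `M`. -/
def CoeffBound {d : ℕ} (s r M : ℝ) (F : Cd d → ℂ) : Prop :=
  ∃ c : (Fin d → ℕ) → ℂ,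
    (∀ α, ‖c α‖ ≤ M * Real.exp (-r * (len α : ℝ) ^ (1 / (2 * s)))) ∧
    ∀ z, HasSum (fun α => c α * e α z) (F z)

theorem CoeffBound.nonneg {d : ℕ} {s r M : ℝ} {F : Cd d → ℂ} (h : CoeffBound s r M F) :
    0 ≤ M := by
  obtain ⟨c, hc, -⟩ := h
  exact nonneg_of_mul_nonneg_left ((norm_nonneg _).trans (hc 0)) (Real.exp_pos _)

theorem CoeffBound.mono {d : ℕ} {s r r' M : ℝ} {F : Cd d → ℂ} (h : CoeffBound s r M F)
    (hr : r' ≤ r) : CoeffBound s r' M F := by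
  have hM := h.nonneg
  obtain ⟨c, hc, hF⟩ := h
  refine ⟨c, fun α => (hc α).trans ?_, hF⟩
  have : (0 : ℝ) ≤ (len α : ℝ) ^ (1 / (2 * s)) := by positivity
  gcongr

/-- The underlying vector space of `𝒜_s(ℂᵈ)`: all functions `F = ∑_α c(F,α) e_α` such that
`|c(F,α)| ≲ e^{-r |α|^{1/(2s)}}` for some `r > 0`. -/
def submoduleA (d : ℕ) (s : ℝ) : Submodule ℂ (Cd d → ℂ) where
  carrier := {F | ∃ r > 0, ∃ M, CoeffBound s r M F}
  zero_mem' := ⟨1, one_pos, 0, 0, by simp, fun z => by simp⟩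
  add_mem' := by
    rintro F G ⟨r, hr, M, hF⟩ ⟨r', hr', M', hG⟩
    obtain ⟨c, hc, hF⟩ := hF.mono (min_le_left r r')
    obtain ⟨c', hc', hG⟩ := hG.mono (min_le_right r r')
    refine ⟨min r r', lt_min hr hr', M + M', c + c', fun α => ?_, fun z => ?_⟩
    · rw [add_mul]
      exact (norm_add_le _ _).trans (add_le_add (hc α) (hc' α))
    · simpa [add_mul] using (hF z).add (hG z)
  smul_mem' := by
    rintro k F ⟨r, hr, M, c, hc, hF⟩
    refine ⟨r, hr, ‖k‖ * M, k • c, fun α => ?_, fun z => ?_⟩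
    · rw [Pi.smul_apply, norm_smul, mul_assoc]
      exact mul_le_mul_of_nonneg_left (hc α) (norm_nonneg _)
    · simpa [mul_assoc] using (hF z).mul_left k

/-- The space `𝒜_s(ℂᵈ)`. It is a type of its own because its topology, given below, is not
the one it would inherit from the product topology on functions. -/
def A (d : ℕ) (s : ℝ) : Type := submoduleA d s

instance (d : ℕ) (s : ℝ) : AddCommGroup (A d s) := inferInstanceAs (AddCommGroup (submoduleA d s))

instance (d : ℕ) (s : ℝ) : Module ℂ (A d s) := inferInstanceAs (Module ℂ (submoduleA d s))

instance (d : ℕ) (s : ℝ) : CoeFun (A d s) (fun _ => Cd d → ℂ) := ⟨fun F => F.1⟩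

/-- The seminorms on `𝒜_s(ℂᵈ)` whose restriction to each of the Banach spaces
`{F : sup_α |c(F,α)| e^{r |α|^{1/(2s)}} < ∞}`, `r > 0`, is continuous. -/
def AdmissibleSeminorm (d : ℕ) (s : ℝ) : Type :=
  {p : Seminorm ℂ (A d s) //
    ∀ r > 0, ∃ C : ℝ, ∀ (F : A d s) (M : ℝ), CoeffBound s r M F → p F ≤ C * M}

instance (d : ℕ) (s : ℝ) : Nonempty (AdmissibleSeminorm d s) :=
  ⟨⟨0, fun _ _ => ⟨0, fun _ _ _ => by simp⟩⟩⟩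

/-- The family of all admissible seminorms. -/
def seminormsA (d : ℕ) (s : ℝ) : SeminormFamily ℂ (A d s) (AdmissibleSeminorm d s) :=
  fun p => p.1

/-- The locally convex inductive limit topology of `𝒜_s(ℂᵈ)`, that is, the finest locally convex
topology for which the inclusions of the above Banach spaces are continuous: it is generated by
all seminorms whose restrictions to these spaces are continuous. -/
instance (d : ℕ) (s : ℝ) : TopologicalSpace (A d s) :=
  (seminormsA d s).moduleFilterBasis.topology

theorem withSeminormsA (d : ℕ) (s : ℝ) : WithSeminorms (seminormsA d s) := ⟨rfl⟩

instance (d : ℕ) (s : ℝ) : IsTopologicalAddGroup (A d s) :=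
  (withSeminormsA d s).topologicalAddGroup

instance (d : ℕ) (s : ℝ) : ContinuousSMul ℂ (A d s) :=
  (withSeminormsA d s).continuousSMul

/-- The monomial `e_α` as an element of `𝒜_s(ℂᵈ)`. -/
def eA {d : ℕ} (s : ℝ) (α : Fin d → ℕ) : A d s :=
  ⟨e α, 1, one_pos, Real.exp ((len α : ℝ) ^ (1 / (2 * s))), Pi.single α 1, fun β => by
    by_cases h : β = α
    · subst h
      rw [← Real.exp_add]
      simp
    · rw [Pi.single_eq_of_ne h, norm_zero]
      positivity, fun z => by
    have h := hasSum_single (f := fun β => (Pi.single α 1 : (Fin d → ℕ) → ℂ) β * e β z) α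
      (fun β hβ => by simp [Pi.single_eq_of_ne hβ])
    simpa using h⟩

/-- The dual space `𝒜_s'(ℂᵈ)` of `𝒜_s(ℂᵈ)`: all continuous linear functionals, with the strong
topology (uniform convergence on bounded sets). -/
abbrev A' (d : ℕ) (s : ℝ) : Type := StrongDual ℂ (A d s)

/-- The function `∑_α u(e_α) e_α` on `ℂᵈ` that stands for the functional `u ∈ 𝒜_s'(ℂᵈ)` under the
identification given by the `A²` pairing, in which the `e_α` are orthonormal. -/
def A'.toFun {d : ℕ} {s : ℝ} (u : A' d s) (w : Cd d) : ℂ := ∑' α, u (eA s α) * e α w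

/-- `a(z,w) = K(z, w̄)` for a function `K` that is holomorphic on `ℂᵈ × ℂᵈ`. -/
def IsAnalyticSymbol {d : ℕ} (a : Cd d → Cd d → ℂ) : Prop :=
  ∃ K : Cd d × Cd d → ℂ, Differentiable ℂ K ∧ ∀ z w, a z w = K (z, conj w)

/-- The integrand `a(z,w) F(w) e^{(z-w,w)}` of a Wick operator, where `(x,y) = ∑ x_j ȳ_j`
(Mathlib's `inner ℂ y x`). -/
def wickIntegrand {d : ℕ} (a : Cd d → Cd d → ℂ) (F : Cd d → ℂ) (z w : Cd d) : ℂ :=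
  a z w * F w * Complex.exp (inner ℂ w (z - w))

/-- `Op_𝔙(a)F = G`: for each `z` the integral defining `Op_𝔙(a)F(z)` converges absolutely and
`π^{-d} ∫ a(z,w) F(w) e^{(z-w,w)} dλ(w) = G(z)`. -/
def WickMapsTo {d : ℕ} (a : Cd d → Cd d → ℂ) (F G : Cd d → ℂ) : Prop :=
  ∀ z, Integrable (wickIntegrand a F z) volume ∧
    (Real.pi ^ d : ℂ)⁻¹ * ∫ w, wickIntegrand a F z w = G z

/-- The weight `e^{½|z-w|² + ρ(|z|^{1/s} + |w|^{1/s})}`. -/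
def weight {d : ℕ} (s ρ : ℝ) (z w : Cd d) : ℝ :=
  Real.exp (1 / 2 * ‖z - w‖ ^ 2 + ρ * (‖z‖ ^ (1 / s) + ‖w‖ ^ (1 / s)))

end Bargmann

end

/-!
The operator with Wick symbol `a` has the integral kernel `a(z,w) e^{(z,w)}` with respect to the
Gaussian measure `π^{-d} e^{-|w|²} dλ(w)`, for which the `e_α` are orthonormal. So the matrix `t`
of `T` with respect to the `e_α` leaves only one candidate, `a(z,w) = e^{-(z,w)} K(z, w̄)` with
`K(z,w) = ∑ t(α,β) e_α(z) e_β(w)`, and the theorem amounts to four facts. Throughout, `p = 1/(2s)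
∈ (0,1]`.

* Joint bounds for `t`. For `T : 𝒜_s → 𝒜_s'` they hold because the multiples `e^{-r|α|^p} e_α`
  form a bounded set (`exists_bound_matrix_of_A`). For `T : 𝒜_s' → 𝒜_s` a gliding hump replaces
  the usual appeal to Baire's theorem: any sequence of multi-indices supports a tempered weight
  that is at least `e^{|α|^p/(n+1)}` at its `n`-th member (`exists_tempered_weight`), and the
  seminorm with this weight contradicts a sequence of violated estimates. Used once, this shows
  that bounded subsets of `𝒜_s` are bounded in one of the defining Banach spaces
  (`exists_bound_of_isVonNBounded`); used again, it gives the joint decay of `t`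
  (`exists_bound_matrix_of_dual`).
* Coefficient bounds `e^{∓r|α|^p}` turn into growth `e^{½|z|² ∓ r'|z|^{2p}}` of the series
  (`exists_decay`, `exists_growth`). The arithmetic-geometric mean inequality reduces this to `∑
  e^{∓r|α|^p} |e_α(z)|²`. In that sum the multi-indices with `|α|` far from `|z|²` are negligible,
  by the exponential moments `∑ y^{|α|} |e_α(z)|² = e^{y|z|²}`. Since `½|z|² + ½|w|² - Re (z,w) =
  ½|z-w|²`, the bounds for `K` become those for `a`.
* The Gaussian pairing of a rapidly decreasing and a tempered series is the sum of the products of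
  the coefficients (`hasSum_pairing`): the growth estimates dominate the termwise integration.
  With the expansions in `𝒜_s` and `𝒜_s'` (`A.hasSum`, `A'.hasSum`) this identifies the operator.
* Uniqueness (`symbol_unique`): the exponentials `w ↦ e^{(w, ζ)}` lie in both domains, and testing
  on them recovers the kernel by the reproducing formula `integral_reproducing`. That formula is
  the mean value property on circles, averaged over the Gaussian measure, after a translation.
-/

noncomputable section

namespace Bargmann

/-! ### Sums over multi-indices -/

theorem hasSum_pi_prod {R : Type*} [NormedCommRing R] [CompleteSpace R] {d : ℕ}
    (g : Fin d → ℕ → R) (hg : ∀ i, Summable fun n => ‖g i n‖) :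
    Summable (fun α : Fin d → ℕ => ‖∏ i, g i (α i)‖) ∧
      HasSum (fun α : Fin d → ℕ => ∏ i, g i (α i)) (∏ i, ∑' n, g i n) := by
  induction d with
  | zero => exact ⟨(hasSum_fintype _).summable, by simp⟩
  | succ d ih =>
    obtain ⟨h1, h2⟩ := ih (fun i => g i.succ) fun i => hg i.succ
    have h3 := (hg 0).mul_norm h1
    rw [← (Fin.consEquiv fun _ : Fin (d + 1) => ℕ).summable_iff,
      ← (Fin.consEquiv fun _ : Fin (d + 1) => ℕ).hasSum_iff, Fin.prod_univ_succ]
    constructor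
    · refine h3.congr fun x => ?_
      simp [Fin.consEquiv, Fin.prod_univ_succ]
    · have h4 := (hg 0).of_norm.hasSum.mul h2 h3.of_norm
      refine h4.congr_fun fun x => ?_
      simp [Fin.consEquiv, Fin.prod_univ_succ]

theorem norm_e {d : ℕ} (α : Fin d → ℕ) (z : Cd d) :
    ‖e α z‖ = (∏ i, ‖z i‖ ^ α i) / Real.sqrt (∏ i, ((α i).factorial : ℝ)) := by
  simp [e, abs_of_nonneg (Real.sqrt_nonneg _)]

theorem e_conj {d : ℕ} (α : Fin d → ℕ) (z : Cd d) : e α (conj z) = star (e α z) := by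
  simp [e, conj]

theorem conj_conj {d : ℕ} (z : Cd d) : conj (conj z) = z := by
  ext i; simp [conj]

theorem norm_conj {d : ℕ} (z : Cd d) : ‖conj z‖ = ‖z‖ := by
  simp [EuclideanSpace.norm_eq, conj]

/-- The multinomial expansion of the Gaussian weight. -/
theorem hasSum_pow_len_mul_norm_e_sq {d : ℕ} (y : ℝ) (z : Cd d) :
    HasSum (fun α => y ^ len α * ‖e α z‖ ^ 2) (Real.exp (y * ‖z‖ ^ 2)) := by
  have h := (hasSum_pi_prod (fun (i : Fin d) n => (y * ‖z i‖ ^ 2) ^ n / (n.factorial : ℝ))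
    fun i => (Real.summable_pow_div_factorial (y * ‖z i‖ ^ 2)).norm).2
  have h2 : ∀ i, ∑' n : ℕ, (y * ‖z i‖ ^ 2) ^ n / (n.factorial : ℝ) =
      Real.exp (y * ‖z i‖ ^ 2) := fun i => by
    rw [Real.exp_eq_exp_ℝ, NormedSpace.exp_eq_tsum_div]
  simp_rw [h2, ← Real.exp_sum, ← Finset.mul_sum, ← EuclideanSpace.norm_sq_eq] at h
  refine h.congr_fun fun α => ?_
  rw [norm_e, div_pow, Real.sq_sqrt (by positivity), Finset.prod_div_distrib, len,
    ← Finset.prod_pow_eq_pow_sum, ← Finset.prod_pow, mul_div_assoc', ← Finset.prod_mul_distrib]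
  congr 1
  exact Finset.prod_congr rfl fun i _ => by rw [mul_pow, ← pow_mul, ← pow_mul, mul_comm 2]

/-- The exponential kernel is the sum of the products of the normalized monomials. -/
theorem hasSum_e_mul_e {d : ℕ} (z w : Cd d) :
    HasSum (fun α => e α z * e α w) (Complex.exp (∑ i, z i * w i)) := by
  have h := (hasSum_pi_prod (fun (i : Fin d) n => (z i * w i) ^ n / (n.factorial : ℂ))
    fun i => NormedSpace.norm_expSeries_div_summable (z i * w i)).2
  have h2 : ∀ i, ∑' n : ℕ, (z i * w i) ^ n / (n.factorial : ℂ) = Complex.exp (z i * w i) :=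
    fun i => by rw [Complex.exp_eq_exp_ℂ, NormedSpace.exp_eq_tsum_div]
  simp_rw [h2, ← Complex.exp_sum] at h
  refine h.congr_fun fun α => ?_
  have h3 : ((Real.sqrt (∏ i, ((α i).factorial : ℝ)) : ℝ) : ℂ) *
      (Real.sqrt (∏ i, ((α i).factorial : ℝ)) : ℝ) = ∏ i, ((α i).factorial : ℂ) := by
    rw [← Complex.ofReal_mul, Real.mul_self_sqrt (by positivity)]
    push_cast
    rfl
  simp only [e]
  rw [div_mul_div_comm, h3, ← Finset.prod_mul_distrib, ← Finset.prod_div_distrib]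
  exact Finset.prod_congr rfl fun i _ => by rw [mul_pow]

/-! ### Exponential weights on multi-indices -/

/-- The weight `e^{ρ|α|^p}` on multi-indices. -/
def expLen {d : ℕ} (p ρ : ℝ) (α : Fin d → ℕ) : ℝ := Real.exp (ρ * (len α : ℝ) ^ p)

theorem expLen_pos {d : ℕ} (p ρ : ℝ) (α : Fin d → ℕ) : 0 < expLen p ρ α := Real.exp_pos _

theorem expLen_add {d : ℕ} (p ρ σ : ℝ) (α : Fin d → ℕ) :
    expLen p (ρ + σ) α = expLen p ρ α * expLen p σ α := by
  rw [expLen, add_mul, Real.exp_add]; rfl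

theorem expLen_mono {d : ℕ} {p ρ σ : ℝ} (h : ρ ≤ σ) (α : Fin d → ℕ) :
    expLen p ρ α ≤ expLen p σ α := by
  unfold expLen
  gcongr

theorem one_le_expLen {d : ℕ} {p ρ : ℝ} (h : 0 ≤ ρ) (α : Fin d → ℕ) : 1 ≤ expLen p ρ α :=
  Real.one_le_exp (by positivity)

/-- A stretched exponential decays faster than any power. -/
theorem exists_exp_neg_mul_rpow_le {p r : ℝ} (hp : 0 < p) (hr : 0 < r) (k : ℝ) :
    ∃ C, 0 ≤ C ∧ ∀ t : ℝ, 0 ≤ t → Real.exp (-r * t ^ p) ≤ C * (1 + t) ^ (-k) := by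
  have h1 : Filter.Tendsto (fun x : ℝ => (x ^ (|k| / p) * Real.exp (-r * x)))
      Filter.atTop (nhds 0) := tendsto_rpow_mul_exp_neg_mul_atTop_nhds_zero _ _ hr
  have h2 := (h1.comp (tendsto_rpow_atTop hp)).eventually (gt_mem_nhds one_pos)
  obtain ⟨N, hN⟩ := Filter.eventually_atTop.1 (h2.and (Filter.eventually_ge_atTop 1))
  have hN1 : 1 ≤ N := (hN N le_rfl).2
  refine ⟨(1 + N) ^ |k|  + 2 ^ |k|, by positivity, fun t ht => ?_⟩
  have key : (1 + t) ^ |k| * Real.exp (-r * t ^ p) ≤ (1 + N) ^ |k|  + 2 ^ |k| := by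
    rcases le_total t N with h | h
    · have h3 : Real.exp (-r * t ^ p) ≤ 1 := Real.exp_le_one_iff.2 (by
        have : 0 ≤ t ^ p := by positivity
        nlinarith)
      have h4 : (1 + t) ^ |k| ≤ (1 + N) ^ |k| :=
        Real.rpow_le_rpow (by linarith) (by linarith) (abs_nonneg _)
      have h5 : (0 : ℝ) ≤ 2 ^ |k| := by positivity
      have h6 : 0 ≤ (1 + t) ^ |k| := by positivity
      nlinarith
    · obtain ⟨h3, h4⟩ := hN t h
      have h5 : (1 + t) ^ |k| ≤ 2 ^ |k| * t ^ |k| := by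
        rw [← Real.mul_rpow (by norm_num) ht]
        exact Real.rpow_le_rpow (by linarith) (by linarith) (abs_nonneg _)
      simp only [Function.comp] at h3
      rw [← Real.rpow_mul ht, mul_div_cancel₀ _ hp.ne'] at h3
      have h6 : (0 : ℝ) ≤ (1 + N) ^ |k| := by positivity
      have h7 : (0 : ℝ) ≤ 2 ^ |k| := by positivity
      calc _ ≤ (2 ^ |k| * t ^ |k|) * Real.exp (-r * t ^ p) := by gcongr
        _ = 2 ^ |k| * (t ^ |k| * Real.exp (-r * t ^ p)) := by ring
        _ ≤ 2 ^ |k| * 1 := by gcongr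
        _ ≤ _ := by linarith
  have h8 : (1 + t) ^ (-|k|) ≤ (1 + t) ^ (-k) :=
    Real.rpow_le_rpow_of_exponent_le (by linarith) (neg_le_neg (le_abs_self k))
  have h9 : 0 < (1 + t) ^ |k| := by positivity
  calc _ = (1 + t) ^ |k| * Real.exp (-r * t ^ p) * (1 + t) ^ (-|k|) := by
        rw [Real.rpow_neg (by linarith)]
        field_simp
    _ ≤ ((1 + N) ^ |k|  + 2 ^ |k|) * (1 + t) ^ (-k) := by
        gcongr

theorem summable_expLen {d : ℕ} {p r : ℝ} (hp : 0 < p) (hr : 0 < r) :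
    Summable (fun α : Fin d → ℕ => expLen p (-r) α) := by
  obtain rfl | hd := Nat.eq_zero_or_pos d
  · exact (hasSum_fintype _).summable
  have hd' : (0 : ℝ) < d := by exact_mod_cast hd
  have h1 : Summable fun n : ℕ => Real.exp (-(r / d) * (n : ℝ) ^ p) := by
    obtain ⟨C, -, hC⟩ := exists_exp_neg_mul_rpow_le hp (div_pos hr hd') 2
    have h := (summable_nat_add_iff 1).2 (Real.summable_nat_rpow_inv.2 one_lt_two)
    refine Summable.of_nonneg_of_le (fun n => (Real.exp_pos _).le) (fun n => hC n n.cast_nonneg)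
      ((h.mul_left C).congr fun n => ?_)
    rw [Real.rpow_neg (by positivity)]
    push_cast
    rw [add_comm]
  have h2 := (hasSum_pi_prod (fun (_ : Fin d) (n : ℕ) => Real.exp (-(r / d) * (n : ℝ) ^ p))
    fun i => h1.norm).2.summable
  refine Summable.of_nonneg_of_le (fun α => (expLen_pos _ _ _).le) (fun α => ?_) h2
  rw [← Real.exp_sum, expLen]
  refine Real.exp_le_exp.2 ?_
  rw [← Finset.mul_sum]
  have h3 : ∑ i, (α i : ℝ) ^ p ≤ d * (len α : ℝ) ^ p := by
    calc _ ≤ ∑ _i : Fin d, (len α : ℝ) ^ p := Finset.sum_le_sum fun i _ => by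
          refine Real.rpow_le_rpow (by positivity) ?_ hp.le
          exact_mod_cast Finset.single_le_sum (f := α) (fun _ _ => Nat.zero_le _)
            (Finset.mem_univ i)
      _ = _ := by simp
  have h4 : r / d * ∑ i, (α i : ℝ) ^ p ≤ r / d * (d * (len α : ℝ) ^ p) := by gcongr
  have h5 : r / d * (d * (len α : ℝ) ^ p) = r * (len α : ℝ) ^ p := by field_simp
  linarith

theorem tendsto_expLen_cofinite {d : ℕ} {p r : ℝ} (hp : 0 < p) (hr : 0 < r) :
    Filter.Tendsto (fun α : Fin d → ℕ => expLen p (-r) α) Filter.cofinite (nhds 0) :=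
  (summable_expLen hp hr).tendsto_cofinite_zero

/-! ### Growth of power series with weighted coefficients -/

theorem rpow_le_one_add {p x : ℝ} (hp : 0 < p) (hp1 : p ≤ 1) (hx : 0 ≤ x) : x ^ p ≤ 1 + x := by
  rcases le_total x 1 with h | h
  · linarith [Real.rpow_le_one hx h hp.le]
  · linarith [Real.rpow_le_self_of_one_le h hp1]

/-- Multi-indices with `|α| < x/4` are paid for by the factor `e^{x/4-|α|}`. -/
theorem expLen_neg_le {d : ℕ} {p r x : ℝ} (hp : 0 < p) (hr : 0 < r) (hx : 0 ≤ x)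
    (α : Fin d → ℕ) :
    expLen p (-r) α ≤ Real.exp (-r * (x / 4) ^ p) * 1 ^ len α +
      Real.exp (x / 4) * Real.exp (-1) ^ len α := by
  rw [one_pow, mul_one, ← Real.exp_nat_mul, ← Real.exp_add]
  rcases le_total (x / 4) (len α) with h | h
  · refine le_add_of_le_of_nonneg (Real.exp_le_exp.2 ?_) (Real.exp_pos _).le
    have := Real.rpow_le_rpow (by positivity) h hp.le
    nlinarith
  · refine le_add_of_nonneg_of_le (Real.exp_pos _).le (Real.exp_le_exp.2 ?_)
    have : (0 : ℝ) ≤ (len α : ℝ) ^ p := by positivity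
    nlinarith

/-- Multi-indices with `|α| > 4x` are paid for by the factor `e^{|α|-2x}`. -/
theorem expLen_pos_le {d : ℕ} {p r x : ℝ} (hp : 0 < p) (hp1 : p ≤ 1) (hr : 0 < r)
    (hr1 : r ≤ 1 / 2) (α : Fin d → ℕ) :
    expLen p r α ≤ Real.exp (r * (4 * x) ^ p) * 1 ^ len α +
      Real.exp (r - 2 * x) * Real.exp 1 ^ len α := by
  rw [one_pow, mul_one, ← Real.exp_nat_mul, ← Real.exp_add]
  rcases le_total (len α : ℝ) (4 * x) with h | h
  · refine le_add_of_le_of_nonneg (Real.exp_le_exp.2 ?_) (Real.exp_pos _).le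
    have := Real.rpow_le_rpow (Nat.cast_nonneg _) h hp.le
    nlinarith
  · refine le_add_of_nonneg_of_le (Real.exp_pos _).le (Real.exp_le_exp.2 ?_)
    have := rpow_le_one_add hp hp1 (x := len α) (by positivity)
    have h0 : (0 : ℝ) ≤ len α := by positivity
    nlinarith

/-- The quadratic sums that the weights `e^{ρ|α|^p}` produce, for a weight below
`A·1^{|α|} + B·y^{|α|}`. -/
theorem sum_mul_norm_e_sq_le {d : ℕ} {f : (Fin d → ℕ) → ℝ} {A B y : ℝ} (z : Cd d)
    (hf0 : ∀ α, 0 ≤ f α) (hf : ∀ α, f α ≤ A * 1 ^ len α + B * y ^ len α) :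
    Summable (fun α => f α * ‖e α z‖ ^ 2) ∧
      ∑' α, f α * ‖e α z‖ ^ 2 ≤ A * Real.exp (‖z‖ ^ 2) + B * Real.exp (y * ‖z‖ ^ 2) := by
  have h1 := ((hasSum_pow_len_mul_norm_e_sq 1 z).mul_left A).add
    ((hasSum_pow_len_mul_norm_e_sq y z).mul_left B)
  rw [one_mul] at h1
  have h2 : ∀ α, f α * ‖e α z‖ ^ 2 ≤
      A * (1 ^ len α * ‖e α z‖ ^ 2) + B * (y ^ len α * ‖e α z‖ ^ 2) := fun α => by
    nlinarith [mul_le_mul_of_nonneg_right (hf α) (sq_nonneg ‖e α z‖)]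
  have h3 := Summable.of_nonneg_of_le (fun α => mul_nonneg (hf0 α) (sq_nonneg ‖e α z‖)) h2
    h1.summable
  exact ⟨h3, hasSum_le h2 h3.hasSum h1⟩

/-- The growth function `e^{½|z|² + σ|z|^{2p}}`. -/
def growth {d : ℕ} (p σ : ℝ) (z : Cd d) : ℝ :=
  Real.exp (1 / 2 * ‖z‖ ^ 2 + σ * (‖z‖ ^ 2) ^ p)

/-- `φ` bounds the absolutely convergent series `∑_α |b_α| |e_α|` pointwise. -/
def HasMajorant {d : ℕ} (b : (Fin d → ℕ) → ℂ) (φ : Cd d → ℝ) : Prop :=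
  ∀ z, Summable (fun α => ‖b α‖ * ‖e α z‖) ∧ ∑' α, ‖b α‖ * ‖e α z‖ ≤ φ z

/-- An estimate of `∑ |e_α|` from one of `∑ |e_α|²`. In place of the Cauchy–Schwarz inequality,
the arithmetic-geometric mean inequality is applied to each term with one parameter `L`, the square
root of the bound for the quadratic sum. -/
theorem sum_expLen_mul_norm_e_le {d : ℕ} {p ρ κ σ D : ℝ}
    (hκ : Summable (fun α : Fin d → ℕ => expLen p (-κ) α))
    (hS : ∀ z : Cd d, Summable (fun α => expLen p (2 * ρ + κ) α * ‖e α z‖ ^ 2) ∧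
      ∑' α, expLen p (2 * ρ + κ) α * ‖e α z‖ ^ 2 ≤
        D * Real.exp (‖z‖ ^ 2 + 2 * σ * (‖z‖ ^ 2) ^ p)) (z : Cd d) :
    Summable (fun α => expLen p ρ α * ‖e α z‖) ∧
      ∑' α, expLen p ρ α * ‖e α z‖ ≤
        (∑' α : Fin d → ℕ, expLen p (-κ) α + D) / 2 * growth p σ z := by
  set L := growth p σ z with hL
  have hLpos : 0 < L := Real.exp_pos _
  obtain ⟨h1, h2⟩ := hS z
  have hLL : Real.exp (‖z‖ ^ 2 + 2 * σ * (‖z‖ ^ 2) ^ p) = L * L := by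
    rw [hL, growth, ← Real.exp_add]
    ring_nf
  have h3 := (hκ.hasSum.mul_left (L / 2)).add (h1.hasSum.mul_left (L⁻¹ / 2))
  have h4 : ∀ α, expLen p ρ α * ‖e α z‖ ≤
      L / 2 * expLen p (-κ) α + L⁻¹ / 2 * (expLen p (2 * ρ + κ) α * ‖e α z‖ ^ 2) := fun α => by
    have ha : expLen p (2 * ρ + κ) α = expLen p ρ α * expLen p ρ α * expLen p κ α := by
      rw [← expLen_add, ← expLen_add]
      ring_nf
    have hb : expLen p (-κ) α * expLen p κ α = 1 := by
      rw [← expLen_add]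
      simp [expLen]
    have hc := expLen_pos p (-κ) α
    have hd := expLen_pos p κ α
    have hx : expLen p κ α = (expLen p (-κ) α)⁻¹ := eq_inv_of_mul_eq_one_right hb
    rw [ha, hx]
    have hq : L / 2 * expLen p (-κ) α + L⁻¹ / 2 *
        (expLen p ρ α * expLen p ρ α * (expLen p (-κ) α)⁻¹ * ‖e α z‖ ^ 2) -
        expLen p ρ α * ‖e α z‖ =
        (L * expLen p (-κ) α - expLen p ρ α * ‖e α z‖) ^ 2 / (2 * L * expLen p (-κ) α) := by
      field_simp
      ring
    have : 0 ≤ (L * expLen p (-κ) α - expLen p ρ α * ‖e α z‖) ^ 2 /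
        (2 * L * expLen p (-κ) α) := by positivity
    linarith
  have h5 := Summable.of_nonneg_of_le
    (fun α => mul_nonneg (expLen_pos p ρ α).le (norm_nonneg (e α z))) h4 h3.summable
  refine ⟨h5, (hasSum_le h4 h5.hasSum h3).trans ?_⟩
  rw [hLL] at h2
  have h6 : L⁻¹ / 2 * ∑' α, expLen p (2 * ρ + κ) α * ‖e α z‖ ^ 2 ≤ L⁻¹ / 2 * (D * (L * L)) := by
    gcongr
  have h7 : L⁻¹ / 2 * (D * (L * L)) = D / 2 * L := by field_simp
  linarith

/-- Coefficients with stretched exponential decay give the same decay relative to `e^{½|z|²}`. -/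
theorem exists_decay (d : ℕ) {p r : ℝ} (hp : 0 < p) (hp1 : p ≤ 1) (hr : 0 < r) :
    ∃ r' > 0, ∃ C, 0 ≤ C ∧ ∀ z : Cd d, Summable (fun α => expLen p (-r) α * ‖e α z‖) ∧
      ∑' α, expLen p (-r) α * ‖e α z‖ ≤ C * growth p (-r') z := by
  have h4 : (0 : ℝ) < 4 ^ p := by positivity
  set ρ := min (r / 4 ^ p) (1 / 4) with hρ
  have hρ0 : 0 < ρ := lt_min (by positivity) (by norm_num)
  refine ⟨ρ / 2, by positivity, _, ?_, fun z => sum_expLen_mul_norm_e_le (κ := r)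
    (D := 1 + Real.exp (1 / 4)) (summable_expLen hp hr) (fun z => ?_) z⟩
  · have : 0 ≤ ∑' α : Fin d → ℕ, expLen p (-r) α := tsum_nonneg fun α => (expLen_pos _ _ _).le
    positivity
  have hx : 0 ≤ ‖z‖ ^ 2 := by positivity
  rw [show 2 * -r + r = -r by ring]
  obtain ⟨h1, h2⟩ := sum_mul_norm_e_sq_le z (fun α => (expLen_pos p (-r) α).le)
    (expLen_neg_le hp hr hx)
  refine ⟨h1, h2.trans ?_⟩
  set x := ‖z‖ ^ 2
  have hxp : 0 ≤ x ^ p := by positivity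
  rw [← Real.exp_add, ← Real.exp_add, add_mul, one_mul, ← Real.exp_add]
  refine add_le_add (Real.exp_le_exp.2 ?_) (Real.exp_le_exp.2 ?_)
  · rw [Real.div_rpow hx (by norm_num)]
    have : ρ * x ^ p ≤ r / 4 ^ p * x ^ p := by gcongr; exact min_le_left _ _
    have h5 : r / 4 ^ p * x ^ p = r * (x ^ p / 4 ^ p) := by ring
    linarith
  -- The other term is at most `e^{3x/4}`, and the missing `x/4` dominates `ρ x^p - 1/4`.
  · have h5 : ρ * x ^ p ≤ 1 / 4 * (1 + x) := by
      gcongr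
      · exact min_le_right _ _
      · exact rpow_le_one_add hp hp1 hx
    have h6 : Real.exp (-1) ≤ 1 / 2 := by
      rw [Real.exp_neg, inv_le_comm₀ (Real.exp_pos _) (by norm_num)]
      linarith [Real.add_one_le_exp (1 : ℝ)]
    nlinarith

/-- Coefficients of sufficiently slow stretched exponential growth give any prescribed stretched
exponential growth relative to `e^{½|z|²}`. -/
theorem exists_growth (d : ℕ) {p r' : ℝ} (hp : 0 < p) (hp1 : p ≤ 1) (hr' : 0 < r') :
    ∃ r > 0, ∃ C, 0 ≤ C ∧ ∀ z : Cd d, Summable (fun α => expLen p r α * ‖e α z‖) ∧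
      ∑' α, expLen p r α * ‖e α z‖ ≤ C * growth p r' z := by
  have h4 : (0 : ℝ) < 4 ^ p := by positivity
  set ρ := min (2 * r' / 4 ^ p) (1 / 2) with hρ
  have hρ0 : 0 < ρ := lt_min (by positivity) (by norm_num)
  refine ⟨ρ / 3, by positivity, _, ?_, fun z => sum_expLen_mul_norm_e_le (κ := ρ / 3)
    (D := 1 + Real.exp ρ) (summable_expLen hp (by positivity)) (fun z => ?_) z⟩
  · have : 0 ≤ ∑' α : Fin d → ℕ, expLen p (-(ρ / 3)) α :=
      tsum_nonneg fun α => (expLen_pos _ _ _).le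
    positivity
  have hx : 0 ≤ ‖z‖ ^ 2 := by positivity
  rw [show 2 * (ρ / 3) + ρ / 3 = ρ by ring]
  obtain ⟨h1, h2⟩ := sum_mul_norm_e_sq_le z (fun α => (expLen_pos p ρ α).le)
    (expLen_pos_le hp hp1 hρ0 (min_le_right _ _))
  refine ⟨h1, h2.trans ?_⟩
  set x := ‖z‖ ^ 2
  have hxp : 0 ≤ x ^ p := by positivity
  rw [← Real.exp_add, ← Real.exp_add, add_mul, one_mul, ← Real.exp_add]
  refine add_le_add (Real.exp_le_exp.2 ?_) (Real.exp_le_exp.2 ?_)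
  · rw [Real.mul_rpow (by norm_num) hx]
    have : ρ * (4 ^ p * x ^ p) ≤ 2 * r' / 4 ^ p * (4 ^ p * x ^ p) := by
      gcongr; exact min_le_left _ _
    have h5 : 2 * r' / 4 ^ p * (4 ^ p * x ^ p) = 2 * r' * x ^ p := by field_simp
    linarith
  -- The other term is at most `e^{(e-2)x}`, and `e ≤ 3`.
  · have h5 : 0 ≤ 2 * r' * x ^ p := by positivity
    have h6 : Real.exp 1 ≤ 3 := by linarith [Real.exp_one_lt_d9]
    nlinarith

theorem HasMajorant.of_norm_le {d : ℕ} {b : (Fin d → ℕ) → ℂ} {f : (Fin d → ℕ) → ℝ}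
    {φ : Cd d → ℝ} {M : ℝ} (hM : 0 ≤ M) (hb : ∀ α, ‖b α‖ ≤ M * f α)
    (hf : ∀ z, Summable (fun α => f α * ‖e α z‖) ∧ ∑' α, f α * ‖e α z‖ ≤ φ z) :
    HasMajorant b fun z => M * φ z := fun z => by
  obtain ⟨h1, h2⟩ := hf z
  have h3 : ∀ α, ‖b α‖ * ‖e α z‖ ≤ M * (f α * ‖e α z‖) := fun α => by
    rw [← mul_assoc]
    exact mul_le_mul_of_nonneg_right (hb α) (norm_nonneg _)
  have h4 := Summable.of_nonneg_of_le (fun α => by positivity) h3 (h1.mul_left M)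
  exact ⟨h4, (hasSum_le h3 h4.hasSum (h1.hasSum.mul_left M)).trans
    (mul_le_mul_of_nonneg_left h2 hM)⟩

theorem HasMajorant.hasSum {d : ℕ} {b : (Fin d → ℕ) → ℂ} {φ : Cd d → ℝ} (h : HasMajorant b φ)
    (z : Cd d) : HasSum (fun α => b α * e α z) (∑' α, b α * e α z) :=
  (Summable.of_norm (by simpa using (h z).1)).hasSum

theorem growth_mul_growth {d : ℕ} (p σ τ : ℝ) (z : Cd d) :
    growth p σ z * growth p τ z * Real.exp (-‖z‖ ^ 2) =
      Real.exp ((σ + τ) * (‖z‖ ^ 2) ^ p) := by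
  rw [growth, growth, ← Real.exp_add, ← Real.exp_add]
  ring_nf

theorem continuous_e {d : ℕ} (α : Fin d → ℕ) : Continuous (e α : Cd d → ℂ) := by
  unfold e
  fun_prop

theorem differentiable_e {d : ℕ} (α : Fin d → ℕ) : Differentiable ℂ (e α : Cd d → ℂ) := by
  unfold e
  fun_prop

/-! ### Gaussian integrals -/

theorem continuous_conj {d : ℕ} : Continuous (conj : Cd d → Cd d) := by
  unfold conj
  fun_prop

theorem integrable_exp_neg_mul_norm_sq_rpow (d : ℕ) {p r : ℝ} (hp : 0 < p) (hr : 0 < r) :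
    Integrable (fun z : Cd d => Real.exp (-r * (‖z‖ ^ 2) ^ p)) := by
  obtain ⟨C, -, hC⟩ := exists_exp_neg_mul_rpow_le (p := 2 * p) (by positivity) hr
    (Module.finrank ℝ (Cd d) + 1)
  have h := (integrable_one_add_norm (E := Cd d) (μ := volume)
    (r := Module.finrank ℝ (Cd d) + 1) (by linarith)).const_mul C
  refine h.mono' (Measurable.aestronglyMeasurable (by fun_prop)) (.of_forall fun z => ?_)
  rw [Real.norm_of_nonneg (Real.exp_pos _).le, ← Real.rpow_natCast, ← Real.rpow_mul (norm_nonneg _)]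
  exact_mod_cast hC ‖z‖ (norm_nonneg _)

theorem integral_gaussian (d : ℕ) :
    ∫ w : Cd d, Complex.exp (-(‖w‖ : ℂ) ^ 2) = (Real.pi : ℂ) ^ d := by
  have h := GaussianFourier.integral_cexp_neg_mul_sq_norm (V := Cd d) (b := 1) (by simp)
  have h2 : Module.finrank ℝ (Cd d) = 2 * d := by
    rw [← Module.finrank_mul_finrank ℝ ℂ (Cd d)]
    simp
  rw [h2] at h
  simp only [neg_mul, one_mul, div_one] at h
  rw [h, Nat.cast_mul, Nat.cast_ofNat, mul_div_cancel_left₀ _ two_ne_zero, Complex.cpow_natCast]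

/-- Coordinatewise multiplication by complex numbers of modulus one, as an isometry. -/
def torus {d : ℕ} (l : Fin d → Circle) : Cd d ≃ₗᵢ[ℝ] Cd d :=
  LinearIsometryEquiv.piLpCongrRight 2 fun i => rotation (l i)

theorem torus_apply {d : ℕ} (l : Fin d → Circle) (w : Cd d) (i : Fin d) :
    torus l w i = l i * w i := by
  simp [torus]

/-- Coordinatewise conjugation, as an isometry. -/
def conjIsometry (d : ℕ) : Cd d ≃ₗᵢ[ℝ] Cd d :=
  LinearIsometryEquiv.piLpCongrRight 2 fun _ => Complex.conjLIE

theorem conjIsometry_apply {d : ℕ} (w : Cd d) : conjIsometry d w = conj w := by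
  ext i
  simp [conjIsometry, conj]

theorem integral_comp_isometry {d : ℕ} (U : Cd d ≃ₗᵢ[ℝ] Cd d) (f : Cd d → ℂ) :
    ∫ w, f (U w) = ∫ w, f w :=
  U.measurePreserving.integral_comp U.toHomeomorph.measurableEmbedding f

theorem integrable_comp_isometry {d : ℕ} (U : Cd d ≃ₗᵢ[ℝ] Cd d) {f : Cd d → ℂ}
    (hf : Integrable f) : Integrable fun w => f (U w) :=
  (U.measurePreserving.integrable_comp_emb U.toHomeomorph.measurableEmbedding).2 hf

/-- The mean value property for the Gaussian measure. It follows from the one on circles about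
the origin, because the Gaussian measure is invariant under scalar rotations. -/
theorem integral_mul_gaussian_of_differentiable {d : ℕ} {k : Cd d → ℂ} (hk : Differentiable ℂ k)
    (hint : Integrable fun u => k u * Complex.exp (-(‖u‖ : ℂ) ^ 2)) :
    ∫ u, k u * Complex.exp (-(‖u‖ : ℂ) ^ 2) = (Real.pi : ℂ) ^ d * k 0 := by
  set J := ∫ u, k u * Complex.exp (-(‖u‖ : ℂ) ^ 2) with hJ
  set f : ℝ → Cd d → ℂ := fun θ u => k (circleMap 0 1 θ • u) * Complex.exp (-(‖u‖ : ℂ) ^ 2)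
    with hf
  have hrot : ∀ θ, f θ = fun u => (fun v => k v * Complex.exp (-(‖v‖ : ℂ) ^ 2))
      (torus (fun _ => Circle.exp θ) u) := fun θ => by
    ext u
    have h : torus (fun _ => Circle.exp θ) u = circleMap 0 1 θ • u := by
      ext i
      simp [torus_apply, circleMap]
    simp only [hf, ← h, LinearIsometryEquiv.norm_map]
  have hf1 : ∀ θ, Integrable (f θ) := fun θ => by
    rw [hrot]
    exact integrable_comp_isometry _ hint
  have hf2 : ∀ θ, ∫ u, f θ u = J := fun θ => by
    rw [hrot]
    exact integral_comp_isometry _ _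
  have hf3 : ∀ θ, ∫ u, ‖f θ u‖ = ∫ u, ‖k u * Complex.exp (-(‖u‖ : ℂ) ^ 2)‖ := fun θ => by
    rw [hrot]
    exact (torus fun _ => Circle.exp θ).measurePreserving.integral_comp
      (torus fun _ => Circle.exp θ).toHomeomorph.measurableEmbedding
      (fun v => ‖k v * Complex.exp (-(‖v‖ : ℂ) ^ 2)‖)
  have hcont : Continuous (Function.uncurry f) := by
    have := hk.continuous
    have hc : Continuous (circleMap (0 : ℂ) 1) := continuous_circleMap 0 1
    simp only [hf, Function.uncurry_def]
    fun_prop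
  have hprod : Integrable (Function.uncurry f)
      ((volume.restrict (Set.Ioc 0 (2 * Real.pi))).prod volume) := by
    rw [integrable_prod_iff hcont.aestronglyMeasurable]
    refine ⟨.of_forall hf1, ?_⟩
    simp only [Function.uncurry_apply_pair, hf3]
    exact integrable_const _
  have hswap := integral_integral_swap hprod
  have hin : ∀ u, ∫ θ in Set.Ioc 0 (2 * Real.pi), f θ u =
      2 * Real.pi * k 0 * Complex.exp (-(‖u‖ : ℂ) ^ 2) := fun u => by
    have hd : Differentiable ℂ fun t : ℂ => k (t • u) := hk.comp (by fun_prop)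
    have h := DiffContOnCl.circleAverage (R := 1) (c := 0) (hd.diffContOnCl)
    rw [Real.circleAverage_def, intervalIntegral.integral_of_le (by positivity)] at h
    simp only [hf]
    rw [integral_mul_const]
    rw [zero_smul] at h
    rw [← h, Complex.real_smul]
    push_cast
    field_simp
  simp only [hf2, hin] at hswap
  rw [integral_const_mul, integral_gaussian] at hswap
  have h2 : (2 * Real.pi : ℂ) ≠ 0 := by simp [Real.pi_ne_zero]
  have h3 : ∫ _ in Set.Ioc 0 (2 * Real.pi), J = 2 * Real.pi * J := by
    rw [setIntegral_const, Real.volume_real_Ioc_of_le (by positivity), Complex.real_smul]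
    push_cast
    ring
  rw [h3] at hswap
  refine mul_left_cancel₀ h2 ?_
  rw [hswap]
  ring

theorem norm_sq_eq_sum {d : ℕ} (w : Cd d) : (‖w‖ : ℂ) ^ 2 = ∑ i, w i * star (w i) := by
  rw [← Complex.ofReal_pow, EuclideanSpace.norm_sq_eq]
  push_cast
  exact Finset.sum_congr rfl fun i _ => (Complex.mul_conj' (w i)).symm

/-- The reproducing property of the kernel `e^{(ζ,w)}` for the Gaussian measure, written in terms
of the conjugate variable. -/
theorem integral_reproducing {d : ℕ} {g : Cd d → ℂ} (hg : Differentiable ℂ g) (ζ : Cd d)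
    (hint : Integrable fun w =>
      g (conj w) * Complex.exp (∑ i, w i * ζ i) * Complex.exp (-(‖w‖ : ℂ) ^ 2)) :
    ∫ w, g (conj w) * Complex.exp (∑ i, w i * ζ i) * Complex.exp (-(‖w‖ : ℂ) ^ 2) =
      (Real.pi : ℂ) ^ d * g ζ := by
  set f : Cd d → ℂ := fun w =>
    g (conj w) * Complex.exp (∑ i, w i * ζ i) * Complex.exp (-(‖w‖ : ℂ) ^ 2) with hf
  set k : Cd d → ℂ := fun u => g (ζ + u) * Complex.exp (-∑ i, u i * star (ζ i)) with hk
  -- Conjugation and the translation by `ζ` turn the integrand into `k` times the Gaussian.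
  have hkey : (fun u => f (conjIsometry d (ζ + u))) =
      fun u => k u * Complex.exp (-(‖u‖ : ℂ) ^ 2) := by
    ext u
    simp only [hf, hk, conjIsometry_apply, conj_conj, norm_conj]
    rw [mul_assoc, mul_assoc, ← Complex.exp_add, ← Complex.exp_add, norm_sq_eq_sum, norm_sq_eq_sum,
      ← sub_eq_add_neg, ← neg_add, ← Finset.sum_sub_distrib, ← Finset.sum_add_distrib,
      ← Finset.sum_neg_distrib]
    congr 2
    refine Finset.sum_congr rfl fun i _ => ?_
    simp only [conj, PiLp.add_apply, star_add]
    ring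
  have hkd : Differentiable ℂ k := by
    have h1 : Differentiable ℂ fun u => g (ζ + u) := hg.comp (by fun_prop)
    simp only [hk]
    fun_prop
  have hI := integrable_comp_isometry (conjIsometry d) hint
  have hI2 := hI.comp_add_left ζ
  have h1 : ∫ u, f (conjIsometry d (ζ + u)) = ∫ w, f w := by
    rw [integral_add_left_eq_self (fun u => f (conjIsometry d u)) ζ, integral_comp_isometry]
  rw [← h1, hkey]
  change Integrable (fun u => f (conjIsometry d (ζ + u))) at hI2
  rw [hkey] at hI2
  rw [integral_mul_gaussian_of_differentiable hkd hI2]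
  simp [hk]

/-- Termwise integration of a series whose finite partial sums are dominated absolutely. -/
theorem hasSum_integral_of_sum_norm_le {ι X : Type*} [Countable ι] [MeasurableSpace X]
    {μ : Measure X} {F : ι → X → ℂ} {f : X → ℂ} {g : X → ℝ}
    (hF : ∀ i, AEStronglyMeasurable (F i) μ) (hg : Integrable g μ)
    (hb : ∀ x, ∀ t : Finset ι, ∑ i ∈ t, ‖F i x‖ ≤ g x) (hs : ∀ x, HasSum (fun i => F i x) (f x)) :
    Integrable f μ ∧ HasSum (fun i => ∫ x, F i x ∂μ) (∫ x, f x ∂μ) := by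
  have hFi : ∀ i, Integrable (F i) μ := fun i => hg.mono' (hF i) (.of_forall fun x => by
    simpa using hb x {i})
  have hm : ∀ t : Finset ι, AEStronglyMeasurable (fun x => ∑ i ∈ t, F i x) μ := fun t =>
    (integrable_finsetSum t fun i _ => hFi i).aestronglyMeasurable
  have hn : ∀ (t : Finset ι) x, ‖∑ i ∈ t, F i x‖ ≤ g x := fun t x =>
    (norm_sum_le _ _).trans (hb x t)
  constructor
  · refine hg.mono' (aestronglyMeasurable_of_tendsto_ae Filter.atTop hm
      (.of_forall fun x => by simpa [HasSum] using hs x)) (.of_forall fun x => ?_)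
    exact le_of_tendsto' (hs x).norm fun t => hn t x
  · have h := tendsto_integral_filter_of_dominated_convergence (l := Filter.atTop) g
      (.of_forall hm) (.of_forall fun t => .of_forall (hn t)) hg
      (.of_forall fun x => by simpa [HasSum] using hs x)
    simp_rw [integral_finsetSum _ fun i _ => hFi i] at h
    simpa [HasSum] using h

/-- The Gaussian pairing of two normalized monomials. -/
def monomialPairing {d : ℕ} (β γ : Fin d → ℕ) : ℂ :=
  ∫ w : Cd d, e β (conj w) * e γ w * Complex.exp (-(‖w‖ : ℂ) ^ 2)

theorem hasSum_monomialPairing {d : ℕ} {b c : (Fin d → ℕ) → ℂ} {φ ψ : Cd d → ℝ}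
    (hc : HasMajorant c φ) (hb : HasMajorant b ψ)
    (hint : Integrable fun w => φ (conj w) * ψ w * Real.exp (-‖w‖ ^ 2)) :
    Integrable (fun w => (∑' β, c β * e β (conj w)) * (∑' γ, b γ * e γ w) *
        Complex.exp (-(‖w‖ : ℂ) ^ 2)) ∧
      HasSum (fun x : (Fin d → ℕ) × (Fin d → ℕ) => c x.1 * b x.2 * monomialPairing x.1 x.2)
        (∫ w, (∑' β, c β * e β (conj w)) * (∑' γ, b γ * e γ w) *
          Complex.exp (-(‖w‖ : ℂ) ^ 2)) := by
  have hG : ∀ w : Cd d, ‖Complex.exp (-(‖w‖ : ℂ) ^ 2)‖ = Real.exp (-‖w‖ ^ 2) := fun w => by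
    rw [Complex.norm_exp, ← Complex.ofReal_pow, ← Complex.ofReal_neg, Complex.ofReal_re]
  have h := hasSum_integral_of_sum_norm_le (μ := volume)
    (F := fun (x : (Fin d → ℕ) × (Fin d → ℕ)) w => c x.1 * e x.1 (conj w) * (b x.2 * e x.2 w) *
      Complex.exp (-(‖w‖ : ℂ) ^ 2))
    (f := fun w => (∑' β, c β * e β (conj w)) * (∑' γ, b γ * e γ w) *
        Complex.exp (-(‖w‖ : ℂ) ^ 2)) (fun x => ?_) hint (fun w t => ?_) fun w => ?_
  · refine ⟨h.1, h.2.congr_fun fun x => ?_⟩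
    rw [monomialPairing, ← integral_const_mul]
    congr 1 with w
    ring
  · have h1 := continuous_e x.1
    have h2 := continuous_e x.2
    have h3 := continuous_conj (d := d)
    refine Continuous.aestronglyMeasurable ?_
    fun_prop
  · obtain ⟨h1, h1'⟩ := hc (conj w)
    obtain ⟨h2, h2'⟩ := hb w
    have h3 := (h1.hasSum.mul h2.hasSum (h1.mul_of_nonneg h2 (fun _ => by positivity)
      fun _ => by positivity)).mul_right (Real.exp (-‖w‖ ^ 2))
    have h4 := sum_le_hasSum t (fun _ _ => by positivity) h3
    simp only [norm_mul, hG]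
    refine h4.trans ?_
    gcongr
    · exact (tsum_nonneg fun _ => by positivity).trans h1'
  · obtain ⟨h1, -⟩ := hc (conj w)
    obtain ⟨h2, -⟩ := hb w
    have h3 : Summable fun x : (Fin d → ℕ) × (Fin d → ℕ) =>
        c x.1 * e x.1 (conj w) * (b x.2 * e x.2 w) :=
      summable_mul_of_summable_norm (f := fun α => c α * e α (conj w))
        (g := fun α => b α * e α w) (by simpa using h1) (by simpa using h2)
    exact ((hc.hasSum (conj w)).mul (hb.hasSum w) h3).mul_right _

theorem monomialPairing_of_ne {d : ℕ} {β γ : Fin d → ℕ} (h : β ≠ γ) :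
    monomialPairing β γ = 0 := by
  obtain ⟨i, hi⟩ := Function.ne_iff.1 h
  -- Rotating the `i`-th coordinate by this angle changes the sign of the integrand.
  set θ : ℝ := Real.pi / ((γ i : ℝ) - β i) with hθ
  set U := torus (Function.update (fun _ => 1) i (Circle.exp θ) : Fin d → Circle)
  have hne : (γ i : ℝ) - β i ≠ 0 := sub_ne_zero.2 fun h' => hi (by exact_mod_cast h'.symm)
  have hprod : ∀ (α : Fin d → ℕ) (w : Cd d),
      e α (U w) = (Circle.exp θ : ℂ) ^ α i * e α w := fun α w => by
    simp only [e, U, torus_apply, mul_pow, Finset.prod_mul_distrib]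
    rw [Finset.prod_eq_single i (fun j _ hj => by simp [Function.update_of_ne hj])
      (fun hj => absurd (Finset.mem_univ i) hj), Function.update_self]
    ring
  have h1 : star ((Circle.exp θ : ℂ) ^ β i) * (Circle.exp θ : ℂ) ^ γ i = -1 := by
    rw [star_pow, Circle.coe_exp, ← Complex.exp_pi_mul_I, Complex.star_def, ← Complex.exp_conj,
      ← Complex.exp_nat_mul, ← Complex.exp_nat_mul, ← Complex.exp_add]
    congr 1
    have h2 : (((γ i : ℝ) - β i) * θ : ℝ) = Real.pi := by rw [hθ]; field_simp
    rw [← h2]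
    simp
    ring
  have h2 : monomialPairing β γ = -monomialPairing β γ := by
    conv_lhs => rw [monomialPairing, ← integral_comp_isometry U]
    rw [monomialPairing, ← integral_neg]
    congr 1 with w
    rw [e_conj, hprod, hprod, LinearIsometryEquiv.norm_map, star_mul', e_conj]
    linear_combination (star (e β w) * e γ w * Complex.exp (-(‖w‖ : ℂ) ^ 2)) * h1
  exact CharZero.eq_neg_self_iff.1 h2

/-! ### Coefficient sequences and the Gaussian pairing -/

/-- Coefficients bounded by `e^{-r|α|^p}` for some `r > 0`. -/
def Rapid {d : ℕ} (p : ℝ) (b : (Fin d → ℕ) → ℂ) : Prop :=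
  ∃ r > 0, ∃ M, 0 ≤ M ∧ ∀ α, ‖b α‖ ≤ M * expLen p (-r) α

/-- Coefficients bounded by `e^{r|α|^p}` for every `r > 0`. -/
def Tempered {d : ℕ} (p : ℝ) (b : (Fin d → ℕ) → ℂ) : Prop :=
  ∀ r > 0, ∃ M, 0 ≤ M ∧ ∀ α, ‖b α‖ ≤ M * expLen p r α

theorem Rapid.tempered {d : ℕ} {p : ℝ} {b : (Fin d → ℕ) → ℂ} (h : Rapid p b) : Tempered p b := by
  obtain ⟨r, hr, M, hM, hb⟩ := h
  exact fun r' hr' => ⟨M, hM, fun α => (hb α).trans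
    (mul_le_mul_of_nonneg_left (expLen_mono (by linarith) α) hM)⟩

theorem Rapid.exists_majorant {d : ℕ} {p : ℝ} (hp : 0 < p) (hp1 : p ≤ 1) {b : (Fin d → ℕ) → ℂ}
    (h : Rapid p b) : ∃ r > 0, ∃ C, 0 ≤ C ∧ HasMajorant b fun z => C * growth p (-r) z := by
  obtain ⟨r, hr, M, hM, hb⟩ := h
  obtain ⟨r', hr', C, hC, h⟩ := exists_decay d hp hp1 hr
  refine ⟨r', hr', M * C, by positivity, ?_⟩
  simpa only [mul_assoc] using HasMajorant.of_norm_le hM hb h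

theorem Tempered.exists_majorant {d : ℕ} {p : ℝ} (hp : 0 < p) (hp1 : p ≤ 1)
    {b : (Fin d → ℕ) → ℂ} (h : Tempered p b) {r : ℝ} (hr : 0 < r) :
    ∃ C, 0 ≤ C ∧ HasMajorant b fun z => C * growth p r z := by
  obtain ⟨r', hr', C, hC, h'⟩ := exists_growth d hp hp1 hr
  obtain ⟨M, hM, hb⟩ := h r' hr'
  refine ⟨M * C, by positivity, ?_⟩
  simpa only [mul_assoc] using HasMajorant.of_norm_le hM hb h'

theorem growth_conj {d : ℕ} (p σ : ℝ) (z : Cd d) : growth p σ (conj z) = growth p σ z := by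
  rw [growth, growth, norm_conj]

/-- The majorants of a rapid and of a tempered series, multiplied with the Gaussian, have an
integrable product. -/
theorem exists_integrable_majorants {d : ℕ} {p : ℝ} (hp : 0 < p) (hp1 : p ≤ 1)
    {b c : (Fin d → ℕ) → ℂ} (h : Rapid p c ∧ Tempered p b ∨ Tempered p c ∧ Rapid p b) :
    ∃ φ ψ : Cd d → ℝ, HasMajorant c φ ∧ HasMajorant b ψ ∧
      Integrable fun w => φ (conj w) * ψ w * Real.exp (-‖w‖ ^ 2) := by
  have key : ∀ {A B σ τ r : ℝ}, 0 < r → σ + τ = -r →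
      Integrable fun w : Cd d =>
        A * growth p σ (conj w) * (B * growth p τ w) * Real.exp (-‖w‖ ^ 2) := by
    intro A B σ τ r hr hst
    refine ((integrable_exp_neg_mul_norm_sq_rpow d hp hr).const_mul (A * B)).congr
      (.of_forall fun w => ?_)
    simp only [growth_conj]
    rw [← hst, ← growth_mul_growth]
    ring
  rcases h with ⟨h1, h2⟩ | ⟨h1, h2⟩
  · obtain ⟨r, hr, A, -, hA⟩ := h1.exists_majorant hp hp1
    obtain ⟨B, -, hB⟩ := h2.exists_majorant hp hp1 (half_pos hr)
    exact ⟨_, _, hA, hB, key (half_pos hr) (by ring)⟩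
  · obtain ⟨r, hr, B, -, hB⟩ := h2.exists_majorant hp hp1
    obtain ⟨A, -, hA⟩ := h1.exists_majorant hp hp1 (half_pos hr)
    exact ⟨_, _, hA, hB, key (half_pos hr) (by ring)⟩

theorem norm_single_le {d : ℕ} (p r : ℝ) (β α : Fin d → ℕ) :
    ‖(Pi.single β 1 : (Fin d → ℕ) → ℂ) α‖ ≤ expLen p r β * expLen p (-r) α := by
  by_cases h : α = β
  · subst h
    rw [← expLen_add]
    simp [expLen]
  · rw [Pi.single_eq_of_ne h, norm_zero]
    exact mul_nonneg (expLen_pos _ _ _).le (expLen_pos _ _ _).le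

theorem rapid_single {d : ℕ} (p : ℝ) (β : Fin d → ℕ) :
    Rapid p (Pi.single β 1 : (Fin d → ℕ) → ℂ) :=
  ⟨1, one_pos, _, (expLen_pos p 1 β).le, norm_single_le p 1 β⟩

theorem hasSum_single_mul {d : ℕ} (β : Fin d → ℕ) (f : (Fin d → ℕ) → ℂ) :
    HasSum (fun α => (Pi.single β 1 : (Fin d → ℕ) → ℂ) α * f α) (f β) := by
  have h := hasSum_single (f := fun α => (Pi.single β 1 : (Fin d → ℕ) → ℂ) α * f α) β
    (fun α hα => by simp [Pi.single_eq_of_ne hα])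
  simpa using h

theorem rapid_e {d : ℕ} {p : ℝ} (hp : 0 < p) (hp1 : p ≤ 1) (ζ : Cd d) :
    Rapid p fun α => e α ζ := by
  obtain ⟨r, hr, C, hC, h⟩ := exists_growth d hp hp1 one_pos
  refine ⟨r, hr, C * growth p 1 ζ, mul_nonneg hC (Real.exp_pos _).le, fun α => ?_⟩
  have h1 : expLen p r α * ‖e α ζ‖ ≤ C * growth p 1 ζ :=
    ((h ζ).1.le_tsum α fun _ _ => mul_nonneg (expLen_pos _ _ _).le (norm_nonneg _)).trans (h ζ).2
  have h2 : expLen p (-r) α * expLen p r α = 1 := by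
    rw [← expLen_add]
    simp [expLen]
  calc ‖e α ζ‖ = expLen p (-r) α * (expLen p r α * ‖e α ζ‖) := by rw [← mul_assoc, h2, one_mul]
    _ ≤ expLen p (-r) α * (C * growth p 1 ζ) :=
      mul_le_mul_of_nonneg_left h1 (expLen_pos _ _ _).le
    _ = _ := mul_comm _ _

theorem hasSum_monomialPairing_diag {d : ℕ} {p : ℝ} (hp : 0 < p) (hp1 : p ≤ 1)
    {b c : (Fin d → ℕ) → ℂ} (h : Rapid p c ∧ Tempered p b ∨ Tempered p c ∧ Rapid p b) :
    Integrable (fun w => (∑' β, c β * e β (conj w)) * (∑' γ, b γ * e γ w) *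
        Complex.exp (-(‖w‖ : ℂ) ^ 2)) ∧
      HasSum (fun β => c β * (b β * monomialPairing β β))
        (∫ w, (∑' β, c β * e β (conj w)) * (∑' γ, b γ * e γ w) *
          Complex.exp (-(‖w‖ : ℂ) ^ 2)) := by
  obtain ⟨φ, ψ, hφ, hψ, hint⟩ := exists_integrable_majorants hp hp1 h
  obtain ⟨h1, h2⟩ := hasSum_monomialPairing hφ hψ hint
  refine ⟨h1, ?_⟩
  have hinj : Function.Injective fun β : Fin d → ℕ => (β, β) := fun β γ h => congrArg Prod.fst h
  rw [← hinj.hasSum_iff] at h2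
  · exact h2.congr_fun fun β => by simp [mul_assoc]
  · rintro ⟨β, γ⟩ hx
    have : β ≠ γ := fun h => hx ⟨β, by simp [h]⟩
    simp [monomialPairing_of_ne this]

/-- The normalized monomials are unit vectors, up to the factor `π^d`: compare the reproducing
formula for `e_β` at `(1,…,1)` with the termwise integration of the reproducing kernel. -/
theorem monomialPairing_self {d : ℕ} (β : Fin d → ℕ) :
    monomialPairing β β = (Real.pi : ℂ) ^ d := by
  set ζ : Cd d := WithLp.toLp 2 fun _ => 1 with hζ
  have hne : e β ζ ≠ 0 := by
    have : Real.sqrt (∏ i, ((β i).factorial : ℝ)) ≠ 0 := by positivity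
    simp [e, hζ, this]
  obtain ⟨h1, h2⟩ := hasSum_monomialPairing_diag one_pos le_rfl
    (Or.inl ⟨rapid_single 1 β, (rapid_e one_pos le_rfl ζ).tempered⟩)
  have hfun : (fun w : Cd d => (∑' α, (Pi.single β 1 : (Fin d → ℕ) → ℂ) α * e α (conj w)) *
      (∑' γ, e γ ζ * e γ w) * Complex.exp (-(‖w‖ : ℂ) ^ 2)) =
      fun w => e β (conj w) * Complex.exp (∑ i, w i * ζ i) * Complex.exp (-(‖w‖ : ℂ) ^ 2) := by
    ext w
    rw [(hasSum_single_mul β _).tsum_eq, (hasSum_e_mul_e ζ w).tsum_eq]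
    simp only [mul_comm (ζ _)]
  rw [hfun] at h1 h2
  rw [integral_reproducing (differentiable_e β) ζ h1] at h2
  have h3 := h2.unique (hasSum_single_mul β fun α => e α ζ * monomialPairing α α)
  exact mul_left_cancel₀ hne (by rw [← h3, mul_comm])

/-- The Gaussian pairing of a rapid and a tempered series. -/
theorem hasSum_pairing {d : ℕ} {p : ℝ} (hp : 0 < p) (hp1 : p ≤ 1)
    {b c : (Fin d → ℕ) → ℂ} (h : Rapid p c ∧ Tempered p b ∨ Tempered p c ∧ Rapid p b) :
    Integrable (fun w => (∑' β, c β * e β (conj w)) * (∑' γ, b γ * e γ w) *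
        Complex.exp (-(‖w‖ : ℂ) ^ 2)) ∧
      HasSum (fun β => c β * b β)
        ((Real.pi ^ d : ℂ)⁻¹ * ∫ w, (∑' β, c β * e β (conj w)) * (∑' γ, b γ * e γ w) *
          Complex.exp (-(‖w‖ : ℂ) ^ 2)) := by
  obtain ⟨h1, h2⟩ := hasSum_monomialPairing_diag hp hp1 h
  refine ⟨h1, (h2.mul_left _).congr_fun fun β => ?_⟩
  have : (Real.pi : ℂ) ^ d ≠ 0 := pow_ne_zero _ (by simp [Real.pi_ne_zero])
  rw [monomialPairing_self]
  field_simp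

/-- The coefficient of `e_α` in `F`, as a Gaussian integral. In this form it is determined by the
function `F` alone; `coeff_eq` identifies it with the coefficient of any rapid expansion. -/
def coeff {d : ℕ} (F : Cd d → ℂ) (α : Fin d → ℕ) : ℂ :=
  (Real.pi ^ d : ℂ)⁻¹ * ∫ w, e α (conj w) * F w * Complex.exp (-(‖w‖ : ℂ) ^ 2)

theorem coeff_eq {d : ℕ} {p : ℝ} (hp : 0 < p) (hp1 : p ≤ 1) {b : (Fin d → ℕ) → ℂ}
    (hb : Rapid p b) {F : Cd d → ℂ} (hF : ∀ z, HasSum (fun α => b α * e α z) (F z)) :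
    coeff F = b := by
  ext α
  obtain ⟨-, h⟩ := hasSum_pairing hp hp1 (Or.inl ⟨rapid_single p α, hb.tempered⟩)
  simp_rw [fun w => (hF w).tsum_eq, fun w => (hasSum_single_mul α fun β => e β (conj w)).tsum_eq]
    at h
  exact h.unique (hasSum_single_mul α b)

/-! ### Kernels and Wick symbols -/

/-- A series of entire functions that converges absolutely and uniformly on bounded sets has an
entire sum. Cauchy's estimate on complex lines bounds the derivatives. -/
theorem differentiable_tsum_of_norm_le {ι E : Type*} [NormedAddCommGroup E] [NormedSpace ℂ E]
    {f : ι → E → ℂ} (hf : ∀ i, Differentiable ℂ (f i))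
    (hb : ∀ R : ℝ, ∃ u : ι → ℝ, Summable u ∧ ∀ i x, ‖x‖ ≤ R → ‖f i x‖ ≤ u i) :
    Differentiable ℂ fun x => ∑' i, f i x := by
  intro x₀
  obtain ⟨u, hu, hfu⟩ := hb (‖x₀‖ + 2)
  have hfd : ∀ i, ∀ x ∈ Metric.ball x₀ 1, ‖fderiv ℂ (f i) x‖ ≤ u i := by
    intro i x hx
    have hx' : ‖x‖ ≤ ‖x₀‖ + 1 := by
      have h1 : ‖x - x₀‖ < 1 := by simpa [dist_eq_norm] using hx
      have h2 := norm_add_le x₀ (x - x₀)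
      rw [add_sub_cancel] at h2
      linarith
    refine ContinuousLinearMap.opNorm_le_bound _
      ((norm_nonneg _).trans (hfu i x (by linarith))) fun v => ?_
    rcases eq_or_ne v 0 with rfl | hv
    · simp
    have hv' : 0 < ‖v‖ := norm_pos_iff.2 hv
    have hφ : Differentiable ℂ fun t : ℂ => f i (x + t • v) := (hf i).comp (by fun_prop)
    have hderiv : deriv (fun t : ℂ => f i (x + t • v)) 0 = fderiv ℂ (f i) x v := by
      have h1 : HasDerivAt (fun t : ℂ => x + t • v) v 0 := by
        simpa using ((hasDerivAt_id (0 : ℂ)).smul_const v).const_add x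
      have h2 : HasFDerivAt (f i) (fderiv ℂ (f i) x) (x + (0 : ℂ) • v) := by
        simpa using (hf i x).hasFDerivAt
      exact (h2.comp_hasDerivAt (0 : ℂ) h1).deriv
    have h := Complex.norm_deriv_le_of_forall_mem_sphere_norm_le (c := (0 : ℂ)) (C := u i)
      (inv_pos.2 hv') hφ.diffContOnCl fun t ht => by
        refine hfu i _ ?_
        have h3 : ‖t‖ = ‖v‖⁻¹ := by simpa using ht
        have h4 := norm_add_le x (t • v)
        rw [norm_smul, h3, inv_mul_cancel₀ hv'.ne'] at h4
        linarith
    rw [hderiv, div_inv_eq_mul] at h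
    exact h
  have hx₀ : x₀ ∈ Metric.ball x₀ 1 := Metric.mem_ball_self one_pos
  exact (hasFDerivAt_tsum_of_isPreconnected hu Metric.isOpen_ball
    (convex_ball x₀ (1 : ℝ)).isPreconnected (fun i x _ => (hf i x).hasFDerivAt) hfd hx₀
    (Summable.of_norm_bounded hu fun i => hfu i x₀ (by linarith)) hx₀).differentiableAt

/-- The function `∑_{α,β} t(α,β) e_α(z) e_β(w)`, holomorphic in both variables; the integral kernel
arises from it by conjugating `w`. -/
def kernel {d : ℕ} (t : (Fin d → ℕ) → (Fin d → ℕ) → ℂ) (z w : Cd d) : ℂ :=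
  ∑' x : (Fin d → ℕ) × (Fin d → ℕ), t x.1 x.2 * e x.1 z * e x.2 w

/-- The Wick symbol whose operator has the matrix `t` with respect to the `e_α`. -/
def symbol {d : ℕ} (t : (Fin d → ℕ) → (Fin d → ℕ) → ℂ) (z w : Cd d) : ℂ :=
  kernel t z (conj w) * Complex.exp (-∑ i, z i * star (w i))

section Matrix

variable {d : ℕ} {p ρ C : ℝ} {t : (Fin d → ℕ) → (Fin d → ℕ) → ℂ}

theorem summable_kernel_bound (h : ∀ z : Cd d, Summable fun α => expLen p ρ α * ‖e α z‖)
    (z w : Cd d) : HasSum (fun x : (Fin d → ℕ) × (Fin d → ℕ) =>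
      C * (expLen p ρ x.1 * ‖e x.1 z‖ * (expLen p ρ x.2 * ‖e x.2 w‖)))
      (C * ((∑' α, expLen p ρ α * ‖e α z‖) * ∑' β, expLen p ρ β * ‖e β w‖)) :=
  ((h z).hasSum.mul (h w).hasSum ((h z).mul_of_nonneg (h w)
    (fun _ => mul_nonneg (expLen_pos _ _ _).le (norm_nonneg _))
    fun _ => mul_nonneg (expLen_pos _ _ _).le (norm_nonneg _))).mul_left C

theorem norm_kernel_term_le (ht : ∀ α β, ‖t α β‖ ≤ C * (expLen p ρ α * expLen p ρ β))
    (x : (Fin d → ℕ) × (Fin d → ℕ)) (z w : Cd d) : ‖t x.1 x.2 * e x.1 z * e x.2 w‖ ≤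
      C * (expLen p ρ x.1 * ‖e x.1 z‖ * (expLen p ρ x.2 * ‖e x.2 w‖)) := by
  rw [norm_mul, norm_mul]
  calc _ ≤ C * (expLen p ρ x.1 * expLen p ρ x.2) * ‖e x.1 z‖ * ‖e x.2 w‖ := by
        gcongr
        exact ht _ _
    _ = _ := by ring

theorem summable_kernel (h : ∀ z : Cd d, Summable fun α => expLen p ρ α * ‖e α z‖)
    (ht : ∀ α β, ‖t α β‖ ≤ C * (expLen p ρ α * expLen p ρ β)) (z w : Cd d) :
    Summable fun x : (Fin d → ℕ) × (Fin d → ℕ) => t x.1 x.2 * e x.1 z * e x.2 w :=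
  Summable.of_norm_bounded (summable_kernel_bound h z w).summable
    fun x => norm_kernel_term_le ht x z w

theorem norm_kernel_le (h : ∀ z : Cd d, Summable fun α => expLen p ρ α * ‖e α z‖)
    (ht : ∀ α β, ‖t α β‖ ≤ C * (expLen p ρ α * expLen p ρ β)) (z w : Cd d) :
    ‖kernel t z w‖ ≤ C * ((∑' α, expLen p ρ α * ‖e α z‖) * ∑' β, expLen p ρ β * ‖e β w‖) :=
  tsum_of_norm_bounded (summable_kernel_bound h z w) fun x => norm_kernel_term_le ht x z w

theorem kernel_eq_tsum (h : ∀ z : Cd d, Summable fun α => expLen p ρ α * ‖e α z‖)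
    (ht : ∀ α β, ‖t α β‖ ≤ C * (expLen p ρ α * expLen p ρ β)) (z w : Cd d) :
    kernel t z w = ∑' β, (∑' α, t α β * e α z) * e β w := by
  have hs := (summable_kernel h ht z w).hasSum
  rw [← (Equiv.prodComm _ _).hasSum_iff] at hs
  rw [kernel, ← hs.tsum_eq, hs.summable.tsum_prod]
  exact tsum_congr fun β => by simp [tsum_mul_right]

theorem norm_e_le_of_norm_le {R : ℝ} (α : Fin d → ℕ) {z : Cd d} (hz : ‖z‖ ≤ R) :
    ‖e α z‖ ≤ ‖e α (WithLp.toLp 2 fun _ : Fin d => (R : ℂ))‖ := by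
  rw [norm_e, norm_e]
  gcongr with i
  calc ‖z i‖ ≤ ‖z‖ := PiLp.norm_apply_le z i
    _ ≤ R := hz
    _ ≤ _ := by simpa using le_abs_self R

theorem differentiable_kernel (h : ∀ z : Cd d, Summable fun α => expLen p ρ α * ‖e α z‖)
    (hC : 0 ≤ C) (ht : ∀ α β, ‖t α β‖ ≤ C * (expLen p ρ α * expLen p ρ β)) :
    Differentiable ℂ fun x : Cd d × Cd d => kernel t x.1 x.2 := by
  refine differentiable_tsum_of_norm_le (fun y => ?_) fun R => ?_
  · have h1 : Differentiable ℂ fun x : Cd d × Cd d => e y.1 x.1 :=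
      (differentiable_e y.1).comp differentiable_fst
    have h2 : Differentiable ℂ fun x : Cd d × Cd d => e y.2 x.2 :=
      (differentiable_e y.2).comp differentiable_snd
    exact (h1.const_mul _).mul h2
  · refine ⟨_, (summable_kernel_bound (C := C) h (WithLp.toLp 2 fun _ : Fin d => (R : ℂ))
      (WithLp.toLp 2 fun _ : Fin d => (R : ℂ))).summable, fun y x hx => ?_⟩
    refine (norm_kernel_term_le ht y x.1 x.2).trans ?_
    have h1 := norm_e_le_of_norm_le y.1 ((norm_fst_le x).trans hx)
    have h2 := norm_e_le_of_norm_le y.2 ((norm_snd_le x).trans hx)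
    have h3 := (expLen_pos p ρ y.1).le
    have h4 := (expLen_pos p ρ y.2).le
    gcongr

theorem isAnalyticSymbol_symbol (h : ∀ z : Cd d, Summable fun α => expLen p ρ α * ‖e α z‖)
    (hC : 0 ≤ C) (ht : ∀ α β, ‖t α β‖ ≤ C * (expLen p ρ α * expLen p ρ β)) :
    IsAnalyticSymbol (symbol t) := by
  refine ⟨fun x => kernel t x.1 x.2 * Complex.exp (-∑ i, x.1 i * x.2 i), ?_, fun z w => rfl⟩
  refine (differentiable_kernel h hC ht).mul (Differentiable.cexp (Differentiable.neg ?_))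
  fun_prop

end Matrix

theorem inner_eq_sum {d : ℕ} (z w : Cd d) : inner ℂ w z = ∑ i, z i * star (w i) := by
  simp [PiLp.inner_apply]

theorem wickIntegrand_eq {d : ℕ} (a : Cd d → Cd d → ℂ) (F : Cd d → ℂ) (z w : Cd d) :
    wickIntegrand a F z w = a z w * Complex.exp (∑ i, z i * star (w i)) * F w *
      Complex.exp (-(‖w‖ : ℂ) ^ 2) := by
  rw [wickIntegrand, inner_sub_right, inner_self_eq_norm_sq_to_K, inner_eq_sum, sub_eq_add_neg,
    Complex.exp_add]
  simp only [Complex.coe_algebraMap]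
  ring

/-- The Gaussian factors of a symbol and of the kernel: `½|z|² + ½|w|² - Re (z,w) = ½|z-w|²`. -/
theorem norm_symbol_le {d : ℕ} {s σ B : ℝ} {t : (Fin d → ℕ) → (Fin d → ℕ) → ℂ}
    (hB : ∀ z w, ‖kernel t z w‖ ≤ B * (growth (1 / (2 * s)) σ z * growth (1 / (2 * s)) σ w))
    (z w : Cd d) : ‖symbol t z w‖ ≤ B * weight s σ z w := by
  have hpow : ∀ v : Cd d, (‖v‖ ^ 2) ^ (1 / (2 * s)) = ‖v‖ ^ (1 / s) := fun v => by
    rw [← Real.rpow_natCast, ← Real.rpow_mul (norm_nonneg _)]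
    congr 1
    push_cast
    rw [mul_one_div, mul_comm 2 s, div_mul_cancel_right₀ two_ne_zero, one_div]
  have h1 : growth (1 / (2 * s)) σ z * growth (1 / (2 * s)) σ w *
      Real.exp (-(inner ℂ w z).re) = weight s σ z w := by
    rw [growth, growth, weight, ← Real.exp_add, ← Real.exp_add, hpow, hpow,
      norm_sub_sq (𝕜 := ℂ) z w, ← inner_conj_symm z w]
    simp only [RCLike.conj_re, RCLike.re_to_complex]
    ring_nf
  rw [symbol, norm_mul, Complex.norm_exp, ← inner_eq_sum, Complex.neg_re, ← h1, ← mul_assoc]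
  refine mul_le_mul_of_nonneg_right ?_ (Real.exp_pos _).le
  have := hB z (conj w)
  rwa [growth_conj] at this

/-- The Wick operator of `symbol t` acts on series by the matrix `t`. -/
theorem wickMapsTo_symbol {d : ℕ} {p ρ C : ℝ} (hp : 0 < p) (hp1 : p ≤ 1)
    {t : (Fin d → ℕ) → (Fin d → ℕ) → ℂ} {b : (Fin d → ℕ) → ℂ} {F G : Cd d → ℂ}
    (h : ∀ z : Cd d, Summable fun α => expLen p ρ α * ‖e α z‖)
    (ht : ∀ α β, ‖t α β‖ ≤ C * (expLen p ρ α * expLen p ρ β))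
    (hF : ∀ w, F w = ∑' γ, b γ * e γ w)
    (hb : ∀ z : Cd d, Rapid p (fun β => ∑' α, t α β * e α z) ∧ Tempered p b ∨
      Tempered p (fun β => ∑' α, t α β * e α z) ∧ Rapid p b)
    (hG : ∀ z : Cd d, HasSum (fun β => (∑' α, t α β * e α z) * b β) (G z)) :
    WickMapsTo (symbol t) F G := by
  intro z
  obtain ⟨h1, h2⟩ := hasSum_pairing hp hp1 (hb z)
  have hfun : wickIntegrand (symbol t) F z = fun w =>
      (∑' β, (∑' α, t α β * e α z) * e β (conj w)) * (∑' γ, b γ * e γ w) *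
        Complex.exp (-(‖w‖ : ℂ) ^ 2) := by
    ext w
    rw [wickIntegrand_eq, symbol, mul_assoc (kernel _ _ _), ← Complex.exp_add, neg_add_cancel,
      Complex.exp_zero, mul_one, kernel_eq_tsum h ht, hF]
  rw [hfun]
  exact ⟨h1, h2.unique (hG z)⟩

/-- A Wick symbol is determined by the action of its operator on the exponentials. -/
theorem symbol_unique {d : ℕ} {a a' : Cd d → Cd d → ℂ} (ha : IsAnalyticSymbol a)
    (ha' : IsAnalyticSymbol a')
    (h : ∀ ζ : Cd d, ∃ G, WickMapsTo a (fun w => Complex.exp (∑ i, w i * ζ i)) G ∧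
      WickMapsTo a' (fun w => Complex.exp (∑ i, w i * ζ i)) G) : a = a' := by
  obtain ⟨K, hK, hKa⟩ := ha
  obtain ⟨K', hK', hKa'⟩ := ha'
  have key : ∀ z ζ, K (z, ζ) = K' (z, ζ) := by
    intro z ζ
    obtain ⟨G, hG, hG'⟩ := h ζ
    obtain ⟨h1, h2⟩ := hG z
    obtain ⟨h1', h2'⟩ := hG' z
    set g : Cd d → ℂ := fun v => (K (z, v) - K' (z, v)) * Complex.exp (∑ i, z i * v i) with hg
    have hgd : Differentiable ℂ g := by
      have e1 : Differentiable ℂ fun v => K (z, v) := hK.comp (by fun_prop)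
      have e2 : Differentiable ℂ fun v => K' (z, v) := hK'.comp (by fun_prop)
      simp only [hg]
      fun_prop
    have hfun : (fun w => g (conj w) * Complex.exp (∑ i, w i * ζ i) *
        Complex.exp (-(‖w‖ : ℂ) ^ 2)) =
        fun w => wickIntegrand a (fun w => Complex.exp (∑ i, w i * ζ i)) z w -
          wickIntegrand a' (fun w => Complex.exp (∑ i, w i * ζ i)) z w := by
      ext w
      rw [wickIntegrand_eq, wickIntegrand_eq, hKa, hKa']
      simp only [hg, conj]
      ring
    have hpi : (Real.pi : ℂ) ^ d ≠ 0 := pow_ne_zero _ (by simp [Real.pi_ne_zero])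
    have hr := integral_reproducing hgd ζ (by rw [hfun]; exact h1.sub h1')
    rw [hfun, integral_sub h1 h1',
      mul_left_cancel₀ (inv_ne_zero hpi) (h2.trans h2'.symm), sub_self] at hr
    have h0 : g ζ = 0 := (mul_eq_zero.1 hr.symm).resolve_left hpi
    exact sub_eq_zero.1 ((mul_eq_zero.1 h0).resolve_right (Complex.exp_ne_zero _))
  ext z w
  rw [hKa, hKa', key]

/-! ### The space `𝒜_s` and its dual -/

theorem exponent_pos {s : ℝ} (hs : 1 / 2 ≤ s) : 0 < 1 / (2 * s) := by
  have : 0 < s := by linarith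
  positivity

theorem exponent_le_one {s : ℝ} (hs : 1 / 2 ≤ s) : 1 / (2 * s) ≤ 1 := by
  rw [div_le_one (by linarith)]
  linarith

theorem CoeffBound.coeff {d : ℕ} {s r M : ℝ} (hs : 1 / 2 ≤ s) (hr : 0 < r) {F : Cd d → ℂ}
    (h : CoeffBound s r M F) :
    (∀ α, ‖coeff F α‖ ≤ M * expLen (1 / (2 * s)) (-r) α) ∧
      ∀ z, HasSum (fun α => Bargmann.coeff F α * e α z) (F z) := by
  have hM := h.nonneg
  obtain ⟨c, hc, hF⟩ := h
  rw [coeff_eq (exponent_pos hs) (exponent_le_one hs) ⟨r, hr, M, hM, hc⟩ hF]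
  exact ⟨hc, hF⟩

theorem A.exists_coeffBound {d : ℕ} {s : ℝ} (F : A d s) : ∃ r > 0, ∃ M, CoeffBound s r M F.1 := F.2

theorem A.hasSum_coeff {d : ℕ} {s : ℝ} (hs : 1 / 2 ≤ s) (F : A d s) (z : Cd d) :
    HasSum (fun α => coeff F.1 α * e α z) (F.1 z) := by
  obtain ⟨r, hr, M, h⟩ := F.exists_coeffBound
  exact (h.coeff hs hr).2 z

theorem A.rapid_coeff {d : ℕ} {s : ℝ} (hs : 1 / 2 ≤ s) (F : A d s) :
    Rapid (1 / (2 * s)) (coeff F.1) := by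
  obtain ⟨r, hr, M, h⟩ := F.exists_coeffBound
  exact ⟨r, hr, M, h.nonneg, (h.coeff hs hr).1⟩

theorem A.coeff_add {d : ℕ} {s : ℝ} (hs : 1 / 2 ≤ s) (F G : A d s) :
    coeff (F + G).1 = coeff F.1 + coeff G.1 := by
  obtain ⟨r, hr, M, hM, hF⟩ := F.rapid_coeff hs
  obtain ⟨r', hr', M', hM', hG⟩ := G.rapid_coeff hs
  refine coeff_eq (exponent_pos hs) (exponent_le_one hs)
    ⟨min r r', lt_min hr hr', M + M', by positivity, fun α => ?_⟩ fun z => ?_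
  · rw [Pi.add_apply, add_mul]
    refine (norm_add_le _ _).trans (add_le_add ((hF α).trans ?_) ((hG α).trans ?_))
    · exact mul_le_mul_of_nonneg_left (expLen_mono (neg_le_neg (min_le_left _ _)) α) hM
    · exact mul_le_mul_of_nonneg_left (expLen_mono (neg_le_neg (min_le_right _ _)) α) hM'
  · simp only [Pi.add_apply, add_mul]
    exact (F.hasSum_coeff hs z).add (G.hasSum_coeff hs z)

theorem A.coeff_smul {d : ℕ} {s : ℝ} (hs : 1 / 2 ≤ s) (k : ℂ) (F : A d s) :
    coeff (k • F).1 = k • coeff F.1 := by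
  obtain ⟨r, hr, M, hM, hF⟩ := F.rapid_coeff hs
  refine coeff_eq (exponent_pos hs) (exponent_le_one hs)
    ⟨r, hr, ‖k‖ * M, by positivity, fun α => ?_⟩ fun z => ?_
  · rw [Pi.smul_apply, norm_smul, mul_assoc]
    exact mul_le_mul_of_nonneg_left (hF α) (norm_nonneg _)
  · simp only [Pi.smul_apply, smul_eq_mul, mul_assoc]
    exact (F.hasSum_coeff hs z).mul_left k

theorem coeffBound_e {d : ℕ} (s r : ℝ) (β : Fin d → ℕ) :
    CoeffBound s r (expLen (1 / (2 * s)) r β) (e β) :=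
  ⟨Pi.single β 1, norm_single_le _ r β, fun z => hasSum_single_mul β fun α => e α z⟩

/-- Continuity of a seminorm forces the estimates that define admissible seminorms. -/
theorem exists_bound_of_continuous_seminorm {d : ℕ} {s : ℝ} {q : Seminorm ℂ (A d s)}
    (hq : Continuous q) {r : ℝ} (hr : 0 < r) :
    ∃ C, ∀ (F : A d s) (M : ℝ), CoeffBound s r M F.1 → q F ≤ C * M := by
  obtain ⟨t, C, -, hC⟩ := Seminorm.bound_of_continuous (withSeminormsA d s) q hq
  choose B hB using fun i : AdmissibleSeminorm d s => i.2 r hr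
  refine ⟨C * ∑ i ∈ t, |B i|, fun F M hF => (hC F).trans ?_⟩
  rw [_root_.smul_apply, NNReal.smul_def, smul_eq_mul, mul_assoc]
  have hM := hF.nonneg
  refine mul_le_mul_of_nonneg_left (Seminorm.finset_sup_apply_le
    (mul_nonneg (Finset.sum_nonneg fun _ _ => abs_nonneg _) hM) fun i hi => ?_) C.2
  refine (hB i F M hF).trans (mul_le_mul_of_nonneg_right ?_ hM)
  exact (le_abs_self _).trans (Finset.single_le_sum (f := fun i => |B i|)
    (fun _ _ => abs_nonneg _) hi)

theorem exists_bound_of_dual {d : ℕ} {s : ℝ} (u : A' d s) {r : ℝ} (hr : 0 < r) :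
    ∃ C, 0 ≤ C ∧ ∀ (F : A d s) (M : ℝ), CoeffBound s r M F.1 → ‖u F‖ ≤ C * M := by
  obtain ⟨C, hC⟩ := exists_bound_of_continuous_seminorm
    (q := (normSeminorm ℂ ℂ).comp u.toLinearMap) (continuous_norm.comp u.continuous) hr
  refine ⟨|C|, abs_nonneg C, fun F M hF => (hC F M hF).trans ?_⟩
  exact mul_le_mul_of_nonneg_right (le_abs_self C) hF.nonneg

theorem tempered_dual {d : ℕ} {s : ℝ} (u : A' d s) :
    Tempered (1 / (2 * s)) fun α => u (eA s α) := fun r hr => by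
  obtain ⟨C, hC0, hC⟩ := exists_bound_of_dual u hr
  exact ⟨C, hC0, fun α => hC _ _ (coeffBound_e s r α)⟩

/-- A linear functional that is bounded on each of the defining Banach spaces, as an element of
the dual. -/
def dualOfBound {d : ℕ} {s : ℝ} (f : A d s →ₗ[ℂ] ℂ)
    (hf : ∀ r > 0, ∃ C : ℝ, ∀ F : A d s, ∀ M : ℝ, CoeffBound s r M F.1 → ‖f F‖ ≤ C * M) :
    A' d s where
  toLinearMap := f
  cont := by
    have h : Continuous ((normSeminorm ℂ ℂ).comp f) := (withSeminormsA d s).continuous_seminorm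
      ⟨(normSeminorm ℂ ℂ).comp f, hf⟩
    refine continuous_of_continuousAt_zero f ?_
    have h1 := h.tendsto 0
    rw [map_zero] at h1
    rw [ContinuousAt, map_zero]
    exact tendsto_zero_iff_norm_tendsto_zero.2 h1

/-- The coefficient functional `F ↦ c(F,β)`. -/
def dualCoeff {d : ℕ} {s : ℝ} (hs : 1 / 2 ≤ s) (β : Fin d → ℕ) : A' d s :=
  dualOfBound
    { toFun := fun F => coeff F.1 β
      map_add' := fun F G => congrFun (A.coeff_add hs F G) β
      map_smul' := fun k F => congrFun (A.coeff_smul hs k F) β }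
    fun r hr => ⟨expLen (1 / (2 * s)) (-r) β, fun _ _ hF =>
      ((hF.coeff hs hr).1 β).trans (mul_comm _ _).le⟩

theorem dualCoeff_apply {d : ℕ} {s : ℝ} (hs : 1 / 2 ≤ s) (β : Fin d → ℕ) (F : A d s) :
    dualCoeff hs β F = coeff F.1 β := rfl

/-- Evaluation at a point. -/
def dualEval {d : ℕ} {s : ℝ} (hs : 1 / 2 ≤ s) (z : Cd d) : A' d s :=
  dualOfBound
    { toFun := fun F => F.1 z
      map_add' := fun _ _ => rfl
      map_smul' := fun _ _ => rfl }
    fun r hr => by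
      obtain ⟨r', -, C, -, hC⟩ := exists_decay d (exponent_pos hs) (exponent_le_one hs) hr
      refine ⟨C * growth (1 / (2 * s)) (-r') z, fun F M hF => ?_⟩
      obtain ⟨h1, h2⟩ := hF.coeff hs hr
      have h3 := tsum_of_norm_bounded (f := fun α => coeff F.1 α * e α z)
        (((hC z).1.hasSum).mul_left M) fun α => by
        rw [norm_mul, ← mul_assoc]
        exact mul_le_mul_of_nonneg_right (h1 α) (norm_nonneg (e α z))
      rw [(h2 z).tsum_eq] at h3
      refine h3.trans ?_
      rw [mul_comm]
      exact mul_le_mul_of_nonneg_right (hC z).2 hF.nonneg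

theorem dualEval_apply {d : ℕ} {s : ℝ} (hs : 1 / 2 ≤ s) (z : Cd d) (F : A d s) :
    dualEval hs z F = F.1 z := rfl

/-- The exponential `w ↦ e^{∑ w_j ζ_j} = ∑_α e_α(ζ) e_α(w)` as an element of `𝒜_s`. -/
def expA {d : ℕ} {s : ℝ} (hs : 1 / 2 ≤ s) (ζ : Cd d) : A d s :=
  ⟨fun w => Complex.exp (∑ i, w i * ζ i), by
    obtain ⟨r, hr, M, -, h⟩ := rapid_e (exponent_pos hs) (exponent_le_one hs) ζ
    refine ⟨r, hr, M, fun α => e α ζ, h, fun w => ?_⟩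
    have := hasSum_e_mul_e ζ w
    simp only [mul_comm (ζ _)] at this
    exact this⟩

theorem coeff_expA {d : ℕ} {s : ℝ} (hs : 1 / 2 ≤ s) (ζ : Cd d) :
    coeff (expA hs ζ : A d s).1 = fun α => e α ζ :=
  coeff_eq one_pos le_rfl (rapid_e one_pos le_rfl ζ) fun w => by
    have := hasSum_e_mul_e ζ w
    simp only [mul_comm (ζ _)] at this
    exact this

/-! ### Bounded sets -/

/-- A tempered weight that is at least `e^{|α|^p/(n+1)}` at the `n`-th member of a given sequence
of multi-indices. -/
theorem exists_tempered_weight {d : ℕ} (p : ℝ) (a : ℕ → Fin d → ℕ) :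
    ∃ v : (Fin d → ℕ) → ℝ, (∀ α, 0 ≤ v α) ∧
      (∀ r > 0, ∃ C, 0 ≤ C ∧ ∀ α, v α ≤ C * expLen p r α) ∧
      ∀ n : ℕ, expLen p (1 / ((n : ℝ) + 1)) (a n) ≤ v (a n) := by
  classical
  set f : ℕ → (Fin d → ℕ) → ℝ := fun n α =>
    if a n = α then expLen p (1 / ((n : ℝ) + 1)) α else 0 with hf
  have hle1 : ∀ n α, f n α ≤ expLen p 1 α := fun n α => by
    simp only [hf]
    split_ifs
    · refine expLen_mono ?_ α
      rw [div_le_one (by positivity)]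
      linarith [(Nat.cast_nonneg n : (0 : ℝ) ≤ n)]
    · exact (expLen_pos _ _ _).le
  have hbdd : ∀ α, BddAbove (Set.range fun n => f n α) := fun α =>
    ⟨expLen p 1 α, by rintro _ ⟨n, rfl⟩; exact hle1 n α⟩
  have hf0 : ∀ n α, 0 ≤ f n α := fun n α => by
    simp only [hf]
    split_ifs
    · exact (expLen_pos _ _ _).le
    · exact le_rfl
  refine ⟨fun α => ⨆ n, f n α, fun α => (hf0 0 α).trans (le_ciSup (hbdd α) 0), fun r hr => ?_,
    fun n => ?_⟩
  · obtain ⟨N, hN⟩ := exists_nat_one_div_lt hr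
    have hsum : 0 ≤ ∑ m ∈ Finset.range N, expLen p 1 (a m) :=
      Finset.sum_nonneg fun _ _ => (expLen_pos _ _ _).le
    refine ⟨1 + ∑ m ∈ Finset.range N, expLen p 1 (a m), by positivity,
      fun α => ciSup_le fun n => ?_⟩
    have h1 := one_le_expLen (p := p) hr.le α
    rcases lt_or_ge n N with hn | hn
    · have h2 : f n α ≤ ∑ m ∈ Finset.range N, expLen p 1 (a m) := by
        by_cases h : a n = α
        · refine (hle1 n α).trans ?_
          rw [← h]
          exact Finset.single_le_sum (f := fun m => expLen p 1 (a m))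
            (fun _ _ => (expLen_pos _ _ _).le) (Finset.mem_range.2 hn)
        · simp only [hf, if_neg h]
          exact hsum
      nlinarith
    · have h2 : f n α ≤ expLen p r α := by
        by_cases h : a n = α
        · simp only [hf, if_pos h]
          refine expLen_mono (le_trans ?_ hN.le) α
          gcongr
        · simp only [hf, if_neg h]
          exact (expLen_pos _ _ _).le
      nlinarith
  · refine le_trans ?_ (le_ciSup (hbdd (a n)) n)
    simp [hf]

theorem summable_weight_mul_coeff {d : ℕ} {s : ℝ} (hs : 1 / 2 ≤ s) {v : (Fin d → ℕ) → ℝ}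
    (hv0 : ∀ α, 0 ≤ v α) {r C M : ℝ} (hr : 0 < r)
    (hv : ∀ α, v α ≤ C * expLen (1 / (2 * s)) (r / 2) α) {F : Cd d → ℂ}
    (hF : CoeffBound s r M F) :
    Summable (fun α => v α * ‖coeff F α‖) ∧ ∑' α, v α * ‖coeff F α‖ ≤
      C * (∑' α : Fin d → ℕ, expLen (1 / (2 * s)) (-(r / 2)) α) * M := by
  have h1 : ∀ α, v α * ‖coeff F α‖ ≤ C * M * expLen (1 / (2 * s)) (-(r / 2)) α := fun α => by
    have h2 : expLen (1 / (2 * s)) (-(r / 2)) α =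
        expLen (1 / (2 * s)) (r / 2) α * expLen (1 / (2 * s)) (-r) α := by
      rw [← expLen_add]
      ring_nf
    rw [h2]
    calc _ ≤ C * expLen (1 / (2 * s)) (r / 2) α * (M * expLen (1 / (2 * s)) (-r) α) :=
          mul_le_mul (hv α) ((hF.coeff hs hr).1 α) (norm_nonneg _) ((hv0 α).trans (hv α))
      _ = _ := by ring
  have h3 := (summable_expLen (d := d) (exponent_pos hs) (half_pos hr)).hasSum.mul_left (C * M)
  have h4 := Summable.of_nonneg_of_le (fun α => mul_nonneg (hv0 α) (norm_nonneg _)) h1 h3.summable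
  exact ⟨h4, (hasSum_le h1 h4.hasSum h3).trans (by ring_nf; exact le_rfl)⟩

/-- The continuous seminorm `∑_α v_α |c(F,α)|` that belongs to a tempered weight `v`. -/
theorem exists_weight_seminorm {d : ℕ} {s : ℝ} (hs : 1 / 2 ≤ s) {v : (Fin d → ℕ) → ℝ}
    (hv0 : ∀ α, 0 ≤ v α)
    (hv : ∀ r > 0, ∃ C, 0 ≤ C ∧ ∀ α, v α ≤ C * expLen (1 / (2 * s)) r α) :
    ∃ q : Seminorm ℂ (A d s), Continuous q ∧ ∀ (F : A d s) α, v α * ‖coeff F.1 α‖ ≤ q F := by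
  have hsum : ∀ F : A d s, Summable fun α => v α * ‖coeff F.1 α‖ := fun F => by
    obtain ⟨r, hr, M, hF⟩ := F.exists_coeffBound
    obtain ⟨C, -, hC⟩ := hv (r / 2) (half_pos hr)
    exact (summable_weight_mul_coeff hs hv0 hr hC hF).1
  let q : Seminorm ℂ (A d s) := Seminorm.of (fun F => ∑' α, v α * ‖coeff F.1 α‖)
    (fun F G => by
      rw [← (hsum F).tsum_add (hsum G)]
      refine (hsum (F + G)).tsum_le_tsum (fun α => ?_) ((hsum F).add (hsum G))
      rw [A.coeff_add hs, Pi.add_apply, ← mul_add]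
      exact mul_le_mul_of_nonneg_left (norm_add_le _ _) (hv0 α))
    (fun k F => by
      rw [← tsum_mul_left]
      refine tsum_congr fun α => ?_
      rw [A.coeff_smul hs, Pi.smul_apply, norm_smul]
      ring)
  refine ⟨q, (withSeminormsA d s).continuous_seminorm ⟨q, fun r hr => ?_⟩, fun F α =>
    (hsum F).le_tsum α fun β _ => mul_nonneg (hv0 β) (norm_nonneg _)⟩
  obtain ⟨C, -, hC⟩ := hv (r / 2) (half_pos hr)
  exact ⟨_, fun F M hF => (summable_weight_mul_coeff hs hv0 hr hC hF).2⟩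

/-- The inductive limit is regular: a bounded set is contained and bounded in one of the defining
Banach spaces. Otherwise the weights `e^{|α|^p/(n+1)}` at multi-indices that violate the `n`-th
estimate make up a continuous seminorm that is unbounded on the set. -/
theorem exists_bound_of_isVonNBounded {d : ℕ} {s : ℝ} (hs : 1 / 2 ≤ s) {S : Set (A d s)}
    (hS : Bornology.IsVonNBounded ℂ S) :
    ∃ r > 0, ∃ M, 0 ≤ M ∧
      ∀ F ∈ S, ∀ α, ‖coeff F.1 α‖ ≤ M * expLen (1 / (2 * s)) (-r) α := by
  by_contra! hcon
  choose F hF a ha using fun n : ℕ => hcon (1 / ((n : ℝ) + 1)) (by positivity) n n.cast_nonneg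
  obtain ⟨v, hv0, hv, hva⟩ := exists_tempered_weight (1 / (2 * s)) a
  obtain ⟨q, hq, hqv⟩ := exists_weight_seminorm hs hv0 hv
  obtain ⟨R, -, hR⟩ := (withSeminormsA d s).isVonNBounded_iff_seminorm_bounded.1 hS
    ⟨q, fun r hr => exists_bound_of_continuous_seminorm hq hr⟩
  obtain ⟨n, hn⟩ := exists_nat_gt R
  have h1 : q (F n) < R := hR _ (hF n)
  have h2 := hqv (F n) (a n)
  have h3 : expLen (1 / (2 * s)) (1 / ((n : ℝ) + 1)) (a n) *
      expLen (1 / (2 * s)) (-(1 / ((n : ℝ) + 1))) (a n) = 1 := by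
    rw [← expLen_add]
    simp [expLen]
  have h4 : (n : ℝ) ≤ v (a n) * ‖coeff (F n).1 (a n)‖ := by
    calc (n : ℝ) = expLen (1 / (2 * s)) (1 / ((n : ℝ) + 1)) (a n) *
          (n * expLen (1 / (2 * s)) (-(1 / ((n : ℝ) + 1))) (a n)) := by
          rw [mul_left_comm, h3, mul_one]
      _ ≤ _ := mul_le_mul (hva n) (ha n).le
        (mul_nonneg n.cast_nonneg (expLen_pos _ _ _).le) (hv0 _)
  linarith

/-- A continuous seminorm on the strong dual decays on the coefficient functionals. -/
theorem exists_bound_dualCoeff {d : ℕ} {s : ℝ} (hs : 1 / 2 ≤ s) {q : Seminorm ℂ (A' d s)}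
    (hq : Continuous q) :
    ∃ r > 0, ∃ C, 0 ≤ C ∧ ∀ β, q (dualCoeff hs β) ≤ C * expLen (1 / (2 * s)) (-r) β := by
  have hnhds : {u : A' d s | q u < 1} ∈ nhds 0 :=
    (isOpen_lt hq continuous_const).mem_nhds (by simp)
  obtain ⟨⟨S, V⟩, ⟨hS, hV⟩, hSV⟩ := ContinuousLinearMap.hasBasis_nhds_zero.mem_iff.1 hnhds
  obtain ⟨ε, hε, hεV⟩ := Metric.mem_nhds_iff.1 hV
  obtain ⟨r, hr, M, hM, hMS⟩ := exists_bound_of_isVonNBounded hs hS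
  refine ⟨r, hr, (M + 1) / ε, by positivity, fun β => ?_⟩
  have hpos := expLen_pos (1 / (2 * s)) (-r) β
  -- With this factor the coefficient functional stays below `ε` on `S`.
  set k : ℝ := ε / ((M + 1) * expLen (1 / (2 * s)) (-r) β) with hk
  have hk0 : 0 < k := by positivity
  have h1 : q ((k : ℂ) • dualCoeff hs β) < 1 := by
    refine hSV fun F hF => hεV ?_
    rw [_root_.smul_apply, mem_ball_zero_iff, norm_smul, dualCoeff_apply,
      Complex.norm_real, Real.norm_of_nonneg hk0.le]
    calc _ ≤ k * (M * expLen (1 / (2 * s)) (-r) β) := by gcongr; exact hMS F hF β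
      _ < k * ((M + 1) * expLen (1 / (2 * s)) (-r) β) := by gcongr; linarith
      _ = ε := by rw [hk]; field_simp
  rw [map_smul_eq_mul, Complex.norm_real, Real.norm_of_nonneg hk0.le] at h1
  have h2 : q (dualCoeff hs β) ≤ 1 / k := by
    rw [le_div_iff₀ hk0]
    linarith
  refine h2.trans (le_of_eq ?_)
  rw [hk]
  field_simp

/-! ### Expansions in `𝒜_s` and in its dual -/

/-- The tails of the expansions of the functions in a bounded subset of a defining Banach space are
uniformly small in a larger one. -/
theorem coeffBound_tail {d : ℕ} {s : ℝ} (hs : 1 / 2 ≤ s) {r M η : ℝ} (hr : 0 < r) (hM : 0 ≤ M)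
    (hη : 0 < η) : ∀ᶠ t : Finset (Fin d → ℕ) in Filter.atTop, ∀ F : A d s,
      (∀ α, ‖coeff F.1 α‖ ≤ M * expLen (1 / (2 * s)) (-r) α) →
        CoeffBound s (r / 2) (M * η) (∑ β ∈ t, coeff F.1 β • eA s β - F).1 := by
  classical
  have h1 := (tendsto_expLen_cofinite (d := d) (exponent_pos hs) (half_pos hr)).eventually
    (gt_mem_nhds hη)
  rw [Filter.eventually_cofinite] at h1
  filter_upwards [Filter.eventually_ge_atTop h1.toFinset] with t ht F hF
  refine ⟨fun α => if α ∈ t then 0 else -coeff F.1 α, fun α => ?_, fun z => ?_⟩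
  · change ‖if α ∈ t then 0 else -coeff F.1 α‖ ≤ M * η * expLen (1 / (2 * s)) (-(r / 2)) α
    have hpos := expLen_pos (1 / (2 * s)) (-(r / 2)) α
    split_ifs with hα
    · rw [norm_zero]
      positivity
    · have h2 : expLen (1 / (2 * s)) (-(r / 2)) α < η := by
        by_contra h
        exact hα (ht (h1.mem_toFinset.2 h))
      rw [norm_neg]
      refine (hF α).trans ?_
      have h3 : expLen (1 / (2 * s)) (-r) α =
          expLen (1 / (2 * s)) (-(r / 2)) α * expLen (1 / (2 * s)) (-(r / 2)) α := by
        rw [← expLen_add]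
        ring_nf
      rw [h3, mul_assoc]
      gcongr
  · have h2 : (∑ β ∈ t, coeff F.1 β • eA s β - F).1 z =
        ∑ β ∈ t, coeff F.1 β * e β z - F.1 z := by
      have h3 := map_sub (dualEval hs z) (∑ β ∈ t, coeff F.1 β • eA s β) F
      rw [map_sum] at h3
      simp only [map_smul, dualEval_apply, smul_eq_mul] at h3
      exact h3
    rw [h2]
    have h4 : HasSum (fun α => (if α ∈ t then coeff F.1 α * e α z else 0))
        (∑ β ∈ t, coeff F.1 β * e β z) := by
      have : HasSum (fun α => (if α ∈ t then coeff F.1 α * e α z else 0))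
          (∑ β ∈ t, if β ∈ t then coeff F.1 β * e β z else 0) :=
        hasSum_sum_of_ne_finset_zero fun α hα => if_neg hα
      rwa [Finset.sum_congr rfl fun β hβ => if_pos hβ] at this
    have h5 := h4.sub (F.hasSum_coeff hs z)
    refine h5.congr_fun fun α => ?_
    by_cases hα : α ∈ t <;> simp [hα]

theorem A.hasSum {d : ℕ} {s : ℝ} (hs : 1 / 2 ≤ s) (F : A d s) :
    HasSum (fun β => coeff F.1 β • eA s β) F := by
  obtain ⟨r, hr, M, hF⟩ := F.exists_coeffBound
  have hM := hF.nonneg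
  rw [HasSum, SummationFilter.unconditional_filter, (withSeminormsA d s).tendsto_nhds _ F]
  intro q ε hε
  obtain ⟨C, hC⟩ := q.2 (r / 2) (half_pos hr)
  have hη : 0 < ε / ((|C| + 1) * (M + 1)) := by positivity
  filter_upwards [coeffBound_tail hs hr hM hη] with t ht
  refine (hC _ _ (ht F (hF.coeff hs hr).1)).trans_lt ?_
  have h1 : C * (M * (ε / ((|C| + 1) * (M + 1)))) = ε * (C * M / ((|C| + 1) * (M + 1))) := by ring
  rw [h1]
  have h2 : C * M < (|C| + 1) * (M + 1) := by
    nlinarith [le_abs_self C, abs_nonneg C]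
  have h3 : C * M / ((|C| + 1) * (M + 1)) < 1 := (div_lt_one (by positivity)).2 h2
  nlinarith

theorem A'.hasSum {d : ℕ} {s : ℝ} (hs : 1 / 2 ≤ s) (u : A' d s) :
    HasSum (fun β => u (eA s β) • dualCoeff hs β) u := by
  rw [HasSum, SummationFilter.unconditional_filter, ← tendsto_sub_nhds_zero_iff,
    ContinuousLinearMap.hasBasis_nhds_zero.tendsto_right_iff]
  rintro ⟨S, V⟩ ⟨hS, hV⟩
  obtain ⟨ε, hε, hεV⟩ := Metric.mem_nhds_iff.1 hV
  obtain ⟨r, hr, M, hM, hMS⟩ := exists_bound_of_isVonNBounded hs hS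
  obtain ⟨C, hC0, hC⟩ := exists_bound_of_dual u (half_pos hr)
  have hη : 0 < ε / ((C + 1) * (M + 1)) := by positivity
  filter_upwards [coeffBound_tail hs hr hM hη] with t ht F hF
  refine hεV ?_
  have h1 : (∑ β ∈ t, u (eA s β) • dualCoeff hs β - u) F =
      u (∑ β ∈ t, coeff F.1 β • eA s β - F) := by
    simp [dualCoeff_apply, mul_comm]
  rw [h1, mem_ball_zero_iff]
  refine (hC _ _ (ht F (hMS F hF))).trans_lt ?_
  have h2 : C * (M * (ε / ((C + 1) * (M + 1)))) = ε * (C * M / ((C + 1) * (M + 1))) := by ring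
  rw [h2]
  have h3 : C * M / ((C + 1) * (M + 1)) < 1 := (div_lt_one (by positivity)).2 (by nlinarith)
  nlinarith

/-! ### Matrices of continuous operators -/

theorem isVonNBounded_weighted_monomials (d : ℕ) (s : ℝ) {r : ℝ} (hr : 0 < r) :
    Bornology.IsVonNBounded ℂ
      (Set.range fun α : Fin d → ℕ => (expLen (1 / (2 * s)) (-r) α : ℂ) • eA s α) := by
  rw [(withSeminormsA d s).isVonNBounded_iff_seminorm_bounded]
  intro q
  obtain ⟨C, hC⟩ := q.2 r hr
  refine ⟨|C| + 1, by positivity, ?_⟩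
  rintro _ ⟨α, rfl⟩
  have h1 := hC (eA s α) _ (coeffBound_e s r α)
  have hpos := expLen_pos (1 / (2 * s)) (-r) α
  have h2 : expLen (1 / (2 * s)) (-r) α * expLen (1 / (2 * s)) r α = 1 := by
    rw [← expLen_add]
    simp [expLen]
  change q.1 _ < _
  rw [map_smul_eq_mul, Complex.norm_real, Real.norm_of_nonneg hpos.le]
  calc _ ≤ expLen (1 / (2 * s)) (-r) α * (C * expLen (1 / (2 * s)) r α) := by gcongr
    _ = C := by rw [mul_left_comm, h2, mul_one]
    _ < _ := by linarith [le_abs_self C]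

/-- The matrix of a continuous operator `𝒜_s → 𝒜_s'` is tempered in both indices jointly. -/
theorem exists_bound_matrix_of_A {d : ℕ} {s : ℝ} (T : A d s →L[ℂ] A' d s) {r : ℝ} (hr : 0 < r) :
    ∃ C, 0 ≤ C ∧ ∀ α β, ‖T (eA s β) (eA s α)‖ ≤
      C * (expLen (1 / (2 * s)) r α * expLen (1 / (2 * s)) r β) := by
  have hS := isVonNBounded_weighted_monomials d s hr
  have hU : {u : A' d s | ∀ F ∈ Set.range fun α : Fin d → ℕ =>
      (expLen (1 / (2 * s)) (-r) α : ℂ) • eA s α, u F ∈ Metric.ball (0 : ℂ) 1} ∈ nhds 0 :=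
    ContinuousLinearMap.hasBasis_nhds_zero.mem_of_mem
      (i := (_, Metric.ball (0 : ℂ) 1)) ⟨hS, Metric.ball_mem_nhds _ one_pos⟩
  have hT : T ⁻¹' {u : A' d s | ∀ F ∈ Set.range fun α : Fin d → ℕ =>
      (expLen (1 / (2 * s)) (-r) α : ℂ) • eA s α, u F ∈ Metric.ball (0 : ℂ) 1} ∈ nhds 0 :=
    T.continuous.continuousAt.preimage_mem_nhds (by rwa [map_zero])
  obtain ⟨k, hk0, hk⟩ := (hS hT).exists_pos
  refine ⟨k, hk0.le, fun α β => ?_⟩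
  obtain ⟨F, hF, hFβ⟩ := hk (k : ℂ) (by simp [abs_of_pos hk0]) ⟨β, rfl⟩
  have h1 := hF _ ⟨α, rfl⟩
  simp only [map_smul, smul_eq_mul, mem_ball_zero_iff, norm_mul, Complex.norm_real,
    Real.norm_of_nonneg (expLen_pos _ _ _).le] at h1
  have h2 : ∀ γ : Fin d → ℕ, expLen (1 / (2 * s)) r γ * expLen (1 / (2 * s)) (-r) γ = 1 :=
    fun γ => by
      rw [← expLen_add]
      simp [expLen]
  have h3 : (expLen (1 / (2 * s)) (-r) β : ℂ) * T (eA s β) (eA s α) = k * T F (eA s α) := by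
    have := congrArg (fun G => T G (eA s α)) hFβ
    simpa using this.symm
  have h4 : expLen (1 / (2 * s)) (-r) β * ‖T (eA s β) (eA s α)‖ = k * ‖T F (eA s α)‖ := by
    have := congrArg norm h3
    simpa only [norm_mul, Complex.norm_real, Real.norm_of_nonneg (expLen_pos _ _ _).le,
      Real.norm_of_nonneg hk0.le] using this
  calc ‖T (eA s β) (eA s α)‖
      = expLen (1 / (2 * s)) r β * (expLen (1 / (2 * s)) (-r) β * ‖T (eA s β) (eA s α)‖) := by
        rw [← mul_assoc, h2, one_mul]
    _ = k * (expLen (1 / (2 * s)) r α * expLen (1 / (2 * s)) r β) *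
          (expLen (1 / (2 * s)) (-r) α * ‖T F (eA s α)‖) := by
        rw [h4]
        linear_combination (-(k * expLen (1 / (2 * s)) r β * ‖T F (eA s α)‖)) * h2 α
    _ ≤ k * (expLen (1 / (2 * s)) r α * expLen (1 / (2 * s)) r β) * 1 := by
        have := expLen_pos (1 / (2 * s)) r α
        have := expLen_pos (1 / (2 * s)) r β
        gcongr
    _ = _ := mul_one _

/-- The matrix of a continuous operator `𝒜_s' → 𝒜_s` decays in both indices jointly. Otherwise the
weights `e^{|α|^p/(n+1)}` at the row indices of violations make up a continuous seminorm on `𝒜_s`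
whose composition with the operator does not decay on the coefficient functionals. -/
theorem exists_bound_matrix_of_dual {d : ℕ} {s : ℝ} (hs : 1 / 2 ≤ s) (T : A' d s →L[ℂ] A d s) :
    ∃ r > 0, ∃ C, 0 ≤ C ∧ ∀ α β, ‖coeff (T (dualCoeff hs β)).1 α‖ ≤
      C * (expLen (1 / (2 * s)) (-r) α * expLen (1 / (2 * s)) (-r) β) := by
  by_contra! hcon
  choose a b hab using fun n : ℕ => hcon (1 / ((n : ℝ) + 1)) (by positivity) n n.cast_nonneg
  obtain ⟨v, hv0, hv, hva⟩ := exists_tempered_weight (1 / (2 * s)) a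
  obtain ⟨q, hq, hqv⟩ := exists_weight_seminorm hs hv0 hv
  obtain ⟨r, hr, C, hC0, hC⟩ := exists_bound_dualCoeff hs (q := q.comp T.toLinearMap)
    (hq.comp T.continuous)
  obtain ⟨n₁, hn₁⟩ := exists_nat_one_div_lt hr
  obtain ⟨n₂, hn₂⟩ := exists_nat_gt C
  set n := max n₁ n₂
  have hnC : C < n := hn₂.trans_le (by exact_mod_cast le_max_right _ _)
  have hnr : 1 / ((n : ℝ) + 1) ≤ r := by
    refine le_trans ?_ hn₁.le
    have : (n₁ : ℝ) ≤ n := by exact_mod_cast le_max_left _ _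
    gcongr
  have h1 : q (T (dualCoeff hs (b n))) ≤ C * expLen (1 / (2 * s)) (-r) (b n) := hC (b n)
  have h2 := hqv (T (dualCoeff hs (b n))) (a n)
  have h3 : expLen (1 / (2 * s)) (1 / ((n : ℝ) + 1)) (a n) *
      expLen (1 / (2 * s)) (-(1 / ((n : ℝ) + 1))) (a n) = 1 := by
    rw [← expLen_add]
    simp [expLen]
  have hpa := expLen_pos (1 / (2 * s)) (-(1 / ((n : ℝ) + 1))) (a n)
  have hpb := expLen_pos (1 / (2 * s)) (-(1 / ((n : ℝ) + 1))) (b n)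
  have h4 : (n : ℝ) * expLen (1 / (2 * s)) (-(1 / ((n : ℝ) + 1))) (b n) ≤
      v (a n) * ‖coeff (T (dualCoeff hs (b n))).1 (a n)‖ := by
    calc _ = expLen (1 / (2 * s)) (1 / ((n : ℝ) + 1)) (a n) *
          (n * (expLen (1 / (2 * s)) (-(1 / ((n : ℝ) + 1))) (a n) *
            expLen (1 / (2 * s)) (-(1 / ((n : ℝ) + 1))) (b n))) := by
          linear_combination (-(n * expLen (1 / (2 * s)) (-(1 / ((n : ℝ) + 1))) (b n))) * h3
      _ ≤ _ := mul_le_mul (hva n) (hab n).le (by positivity) (hv0 _)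
  have h5 : C * expLen (1 / (2 * s)) (-r) (b n) ≤
      C * expLen (1 / (2 * s)) (-(1 / ((n : ℝ) + 1))) (b n) :=
    mul_le_mul_of_nonneg_left (expLen_mono (neg_le_neg hnr) _) hC0
  have h6 : C * expLen (1 / (2 * s)) (-(1 / ((n : ℝ) + 1))) (b n) <
      n * expLen (1 / (2 * s)) (-(1 / ((n : ℝ) + 1))) (b n) := by gcongr
  linarith

theorem norm_kernel_le_growth {d : ℕ} {p ρ σ C D : ℝ} {t : (Fin d → ℕ) → (Fin d → ℕ) → ℂ}
    (hC : 0 ≤ C) (hD : 0 ≤ D)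
    (h : ∀ z : Cd d, Summable (fun α => expLen p ρ α * ‖e α z‖) ∧
      ∑' α, expLen p ρ α * ‖e α z‖ ≤ D * growth p σ z)
    (ht : ∀ α β, ‖t α β‖ ≤ C * (expLen p ρ α * expLen p ρ β)) (z w : Cd d) :
    ‖kernel t z w‖ ≤ C * (D * D) * (growth p σ z * growth p σ w) := by
  have hg : ∀ v : Cd d, 0 ≤ growth p σ v := fun v => (Real.exp_pos _).le
  calc _ ≤ C * ((∑' α, expLen p ρ α * ‖e α z‖) * ∑' β, expLen p ρ β * ‖e β w‖) :=
        norm_kernel_le (fun z => (h z).1) ht z w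
    _ ≤ C * ((D * growth p σ z) * (D * growth p σ w)) := by
        refine mul_le_mul_of_nonneg_left (mul_le_mul (h z).2 (h w).2 ?_ ?_) hC
        · exact tsum_nonneg fun _ => mul_nonneg (expLen_pos _ _ _).le (norm_nonneg _)
        · exact mul_nonneg hD (hg z)
    _ = _ := by ring

/-- The sums over the row index inherit the bound in the column index. -/
theorem norm_tsum_column_le {d : ℕ} {p ρ C : ℝ} {t : (Fin d → ℕ) → (Fin d → ℕ) → ℂ}
    (h : ∀ z : Cd d, Summable fun α => expLen p ρ α * ‖e α z‖)
    (ht : ∀ α β, ‖t α β‖ ≤ C * (expLen p ρ α * expLen p ρ β)) (z : Cd d) (β : Fin d → ℕ) :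
    ‖∑' α, t α β * e α z‖ ≤ C * (∑' α, expLen p ρ α * ‖e α z‖) * expLen p ρ β := by
  refine (tsum_of_norm_bounded (f := fun α => t α β * e α z)
    ((h z).hasSum.mul_left (C * expLen p ρ β)) fun α => ?_).trans (by ring_nf; exact le_rfl)
  rw [norm_mul]
  calc _ ≤ C * (expLen p ρ α * expLen p ρ β) * ‖e α z‖ := by gcongr; exact ht α β
    _ = _ := by ring

/-- An operator `𝒜_s' → 𝒜_s` acts by its matrix. -/
theorem hasSum_apply_dual {d : ℕ} {s : ℝ} (hs : 1 / 2 ≤ s) (T : A' d s →L[ℂ] A d s)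
    (u : A' d s) (z : Cd d) :
    HasSum (fun β => (∑' α, coeff (T (dualCoeff hs β)).1 α * e α z) * u (eA s β)) ((T u).1 z) := by
  have h := (u.hasSum hs).mapL ((dualEval hs z).comp T)
  refine h.congr_fun fun β => ?_
  rw [((T (dualCoeff hs β)).hasSum_coeff hs z).tsum_eq, map_smul, smul_eq_mul, mul_comm]
  rfl

theorem toFun_eq {d : ℕ} {s : ℝ} (hs : 1 / 2 ≤ s) (u : A' d s) (z : Cd d) :
    u.toFun z = u (expA hs z) := by
  have h := ((expA hs z : A d s).hasSum hs).mapL u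
  rw [A'.toFun, ← h.tsum_eq]
  refine tsum_congr fun α => ?_
  rw [map_smul, coeff_expA, smul_eq_mul, mul_comm]

/-- An operator `𝒜_s → 𝒜_s'` acts by its matrix. -/
theorem hasSum_apply_A {d : ℕ} {s : ℝ} (hs : 1 / 2 ≤ s) (T : A d s →L[ℂ] A' d s)
    (F : A d s) (z : Cd d) :
    HasSum (fun β => (∑' α, T (eA s β) (eA s α) * e α z) * coeff F.1 β) ((T F).toFun z) := by
  let ev : A' d s →L[ℂ] ℂ :=
    { toFun := fun u => u (expA hs z)
      map_add' := fun _ _ => rfl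
      map_smul' := fun _ _ => rfl
      cont := continuous_eval_const (expA hs z) }
  have h := ((F.hasSum hs).mapL T).mapL ev
  rw [toFun_eq hs]
  refine h.congr_fun fun β => ?_
  have h2 := toFun_eq hs (T (eA s β)) z
  rw [A'.toFun] at h2
  rw [h2, map_smul, map_smul, smul_eq_mul, mul_comm]
  rfl

theorem toFun_dualEval {d : ℕ} {s : ℝ} (hs : 1 / 2 ≤ s) (ζ : Cd d) :
    (dualEval hs ζ : A' d s).toFun = fun w => Complex.exp (∑ i, w i * ζ i) := by
  ext w
  rw [toFun_eq hs, dualEval_apply]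
  simp only [expA, mul_comm]

end Bargmann

end

theorem theorem4p1 (d : ℕ) (s : ℝ) (hs : 1 / 2 ≤ s) :
    (∀ T : Bargmann.A' d s →L[ℂ] Bargmann.A d s,
      ∃! a : Bargmann.Cd d → Bargmann.Cd d → ℂ,
        Bargmann.IsAnalyticSymbol a ∧
        (∃ r : ℝ, 0 < r ∧ ∃ C : ℝ, ∀ z w, ‖a z w‖ ≤ C * Bargmann.weight s (-r) z w) ∧
        ∀ F : Bargmann.A' d s, Bargmann.WickMapsTo a (Bargmann.A'.toFun F) (T F)) ∧
    (∀ T : Bargmann.A d s →L[ℂ] Bargmann.A' d s,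
      ∃! a : Bargmann.Cd d → Bargmann.Cd d → ℂ,
        Bargmann.IsAnalyticSymbol a ∧
        (∀ r : ℝ, 0 < r → ∃ C : ℝ, ∀ z w, ‖a z w‖ ≤ C * Bargmann.weight s r z w) ∧
        ∀ F : Bargmann.A d s, Bargmann.WickMapsTo a F (Bargmann.A'.toFun (T F))) := by
  have hp := Bargmann.exponent_pos hs
  have hp1 := Bargmann.exponent_le_one hs
  constructor
  · intro T
    obtain ⟨r, hr, C, hC, ht⟩ := Bargmann.exists_bound_matrix_of_dual hs T
    obtain ⟨r', hr', D, hD, h⟩ := Bargmann.exists_decay d hp hp1 hr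
    have hA := Bargmann.isAnalyticSymbol_symbol (fun z => (h z).1) hC ht
    have hT : ∀ u : Bargmann.A' d s, Bargmann.WickMapsTo
        (Bargmann.symbol fun α β => Bargmann.coeff (T (Bargmann.dualCoeff hs β)).1 α)
        u.toFun (T u).1 := fun u =>
      Bargmann.wickMapsTo_symbol hp hp1 (fun z => (h z).1) ht (fun w => rfl)
        (fun z => Or.inl ⟨⟨r, hr, _, mul_nonneg hC (tsum_nonneg fun _ =>
          mul_nonneg (Bargmann.expLen_pos _ _ _).le (norm_nonneg _)),
          Bargmann.norm_tsum_column_le (fun z => (h z).1) ht z⟩, Bargmann.tempered_dual u⟩)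
        (Bargmann.hasSum_apply_dual hs T u)
    refine ⟨_, ⟨hA, ⟨r', hr', _,
      Bargmann.norm_symbol_le (Bargmann.norm_kernel_le_growth hC hD h ht)⟩, hT⟩, ?_⟩
    rintro a ⟨ha, -, haT⟩
    refine Bargmann.symbol_unique ha hA fun ζ => ⟨(T (Bargmann.dualEval hs ζ)).1, ?_⟩
    rw [← Bargmann.toFun_dualEval hs]
    exact ⟨haT _, hT _⟩
  · intro T
    choose C hC ht using fun (r : ℝ) (hr : 0 < r) => Bargmann.exists_bound_matrix_of_A T hr
    choose ρ hρ D hD h using fun (r : ℝ) (hr : 0 < r) => Bargmann.exists_growth d hp hp1 hr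
    have hA := Bargmann.isAnalyticSymbol_symbol (fun z => (h 1 one_pos z).1) (hC _ (hρ 1 one_pos))
      (ht _ (hρ 1 one_pos))
    have hcol : ∀ z : Bargmann.Cd d, Bargmann.Tempered (1 / (2 * s))
        fun β => ∑' α, T (Bargmann.eA s β) (Bargmann.eA s α) * Bargmann.e α z := by
      intro z r hr
      -- Only exponents below `ρ 1` are known to give convergent sums over the row index.
      set κ := min r (ρ 1 one_pos)
      have hκ : 0 < κ := lt_min hr (hρ 1 one_pos)
      have hsum : ∀ z : Bargmann.Cd d,
          Summable fun α => Bargmann.expLen (1 / (2 * s)) κ α * ‖Bargmann.e α z‖ := fun z =>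
        Summable.of_nonneg_of_le
          (fun _ => mul_nonneg (Bargmann.expLen_pos _ _ _).le (norm_nonneg _))
          (fun α => mul_le_mul_of_nonneg_right (Bargmann.expLen_mono (min_le_right _ _) α)
            (norm_nonneg _)) (h 1 one_pos z).1
      have hnn : 0 ≤ C κ hκ *
          ∑' α, Bargmann.expLen (1 / (2 * s)) κ α * ‖Bargmann.e α z‖ :=
        mul_nonneg (hC κ hκ) (tsum_nonneg fun _ =>
          mul_nonneg (Bargmann.expLen_pos _ _ _).le (norm_nonneg _))
      exact ⟨_, hnn, fun β => (Bargmann.norm_tsum_column_le hsum (ht κ hκ) z β).trans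
        (mul_le_mul_of_nonneg_left (Bargmann.expLen_mono (min_le_left _ _) β) hnn)⟩
    have hT : ∀ F : Bargmann.A d s, Bargmann.WickMapsTo
        (Bargmann.symbol fun α β => T (Bargmann.eA s β) (Bargmann.eA s α))
        F.1 (T F).toFun := fun F =>
      Bargmann.wickMapsTo_symbol hp hp1 (fun z => (h 1 one_pos z).1) (ht _ (hρ 1 one_pos))
        (fun w => (F.hasSum_coeff hs w).tsum_eq.symm)
        (fun z => Or.inr ⟨hcol z, F.rapid_coeff hs⟩) (Bargmann.hasSum_apply_A hs T F)
    refine ⟨_, ⟨hA, fun r hr => ⟨_, Bargmann.norm_symbol_le (Bargmann.norm_kernel_le_growth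
      (hC _ (hρ r hr)) (hD r hr) (h r hr) (ht _ (hρ r hr)))⟩, hT⟩, ?_⟩
    rintro a ⟨ha, -, haT⟩
    exact Bargmann.symbol_unique ha hA fun ζ =>
      ⟨(T (Bargmann.expA hs ζ)).toFun, haT (Bargmann.expA hs ζ), hT (Bargmann.expA hs ζ)⟩
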